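/- Let $n\ge 1$, and let $\mathcal B_n$ be the set of braid words on $n$ strands, i.e. finite words in $\sigma_1^{\pm1},\dots,\sigma_{n-1}^{\pm1}$. For $w\in\mathcal B_n$ let $\beta(w)$ be the oriented link obtained as the braid closure of $w$. For a (nonempty) oriented link $K$ let $\nabla(K)\in\mathbb Z[z]$ be its Conway polynomial, the isotopy invariant characterized by $\nabla(\mathrm{unknot})=1$ and the skein relation $\nabla(K_+)-\nabla(K_-)=z\,\nabla(K_0)$; here the crossing $\sigma_i$ is positive. Let $w=w_1\cdots w_m\in\mathcal B_n$ be a homogeneous braid word: for each $1\le i\le n-1$, the letter $\sigma_i$ occurs in $w$ if and only if $\sigma_i^{-1}$ does not. Let $\alpha(i)\in\{1,-1\}$ be the sign of the exponent with which $\sigma_i$ occurs in $w$, and let $x(j)$ be the strand index of $w_j$, so that $w_j=\sigma_{x(j)}^{\alpha(x(j))}$. Then $$\deg\nabla(\beta(w))=m-n+1,$$ and the leading coefficient of $\nabla(\beta(w))$ is $$\prod_{i=1}^{n-1}\alpha(i)\;\prod_{j=1}^{m}\alpha(x(j)).$$ -/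

import Mathlib

open Polynomial

namespace Knot

/-! ## Oriented link diagrams

An oriented link diagram in general position with respect to the height function is read from
the top of the page to the bottom. Every horizontal line that avoids the critical levels meets it
in finitely many strands, numbered `0, 1, 2, ...` from the left; we record the orientation of
each strand as a Boolean (`true` : down the page, `false` : up the page). At a critical level
there is exactly one local maximum, one local minimum or one crossing. -/

/-- The elementary pieces of a diagram.
* `max b`: a local maximum. It creates two adjacent strands; the left one is oriented down the
  page iff `b = true`, and the right one is oriented oppositely.
* `min`: a local minimum. It joins two adjacent (coherently oriented) strands.
* `cross s`: two adjacent strands exchange their positions. If `s = true`, the strand that comes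
  from the upper left (and leaves to the lower right) passes under the other one; if `s = false`
  it passes over. -/
inductive Piece : Type
  | max (b : Bool)
  | min
  | cross (s : Bool)
  deriving DecidableEq

/-- The number of strands entering a piece from above. -/
def Piece.numIn : Piece → ℕ
  | .max _ => 0
  | .min => 2
  | .cross _ => 2

/-- The number of strands leaving a piece below. -/
def Piece.numOut : Piece → ℕ
  | .max _ => 2
  | .min => 0
  | .cross _ => 2

/-- How a piece, placed at the left end of a list of oriented strands, changes that list;
`none` if it cannot be placed there. -/
def Piece.act : Piece → List Bool → Option (List Bool)
  | .max b, st => some (b :: (!b) :: st)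
  | .min, a :: b :: st => if a = !b then some st else none
  | .cross _, a :: b :: st => some (b :: a :: st)
  | _, _ => none

/-- A critical level: a piece, together with the number of strands to the left of it. -/
structure Event : Type where
  piece : Piece
  pos : ℕ
  deriving DecidableEq

/-- A local maximum with `i` strands to its left. -/
abbrev Event.max (i : ℕ) (b : Bool) : Event := ⟨.max b, i⟩

/-- A local minimum with `i` strands to its left. -/
abbrev Event.min (i : ℕ) : Event := ⟨.min, i⟩

/-- A crossing with `i` strands to its left. -/
abbrev Event.cross (i : ℕ) (s : Bool) : Event := ⟨.cross s, i⟩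

/-- The oriented strands below a critical level, given those above it (`none` if the event does
not fit the strands above it). -/
def Event.act (e : Event) (st : List Bool) : Option (List Bool) :=
  if e.pos ≤ st.length then
    (e.piece.act (st.drop e.pos)).map (fun t => st.take e.pos ++ t)
  else none

/-- The oriented strands below a sequence of critical levels, given those above it. -/
def run : List Event → List Bool → Option (List Bool)
  | [], st => some st
  | e :: es, st => (e.act st).bind (run es)

/-- An oriented diagram of a (nonempty) link. -/
@[ext]
structure Diagram : Type where
  events : List Event
  ne_nil : events ≠ []
  closed : run events [] = some []

/-! ## Isotopy: planar isotopies and Reidemeister moves -/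

/-- The local moves on diagrams: the moves generating planar isotopy of diagrams in general
position (exchange of levels, cancellation of a maximum with a minimum, sliding a strand past an
extremum) and the three Reidemeister moves. -/
inductive Move : List Event → List Event → Prop
  /-- Two pieces lying side by side may exchange their levels (`q` lies to the right of `p`). -/
  | exchange (p q : Piece) (i j : ℕ) (h : i ≤ j) :
      Move [⟨p, i⟩, ⟨q, j + p.numOut⟩] [⟨q, j + p.numIn⟩, ⟨p, i⟩]
  | zigzagRight (i : ℕ) (b : Bool) : Move [.max (i + 1) b, .min i] []
  | zigzagLeft (i : ℕ) (b : Bool) : Move [.max i b, .min (i + 1)] []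
  | slideMax (i : ℕ) (b s : Bool) :
      Move [.max i b, .cross (i + 1) s] [.max (i + 1) b, .cross i (!s)]
  | slideMin (i : ℕ) (s : Bool) :
      Move [.cross (i + 1) s, .min i] [.cross i (!s), .min (i + 1)]
  | reidemeister1Right (i : ℕ) (b s : Bool) :
      Move [.max (i + 1) b, .cross i s, .min (i + 1)] []
  | reidemeister1Left (i : ℕ) (b s : Bool) :
      Move [.max i b, .cross (i + 1) s, .min i] []
  | reidemeister2 (i : ℕ) (s : Bool) : Move [.cross i s, .cross i (!s)] []
  | reidemeister3 (i : ℕ) (s : Bool) :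
      Move [.cross i s, .cross (i + 1) s, .cross i s]
        [.cross (i + 1) s, .cross i s, .cross (i + 1) s]

/-- Two diagrams differ by one local move. -/
def Diagram.Step (D D' : Diagram) : Prop :=
  ∃ P S L L' : List Event,
    Move L L' ∧ D.events = P ++ L ++ S ∧ D'.events = P ++ L' ++ S

/-- (Nonempty) oriented links in the three-sphere up to isotopy: oriented diagrams modulo the
equivalence relation generated by planar isotopy and the Reidemeister moves. -/
def Link : Type := Quot Diagram.Step

/-- The link represented by a diagram. -/
def Diagram.link (D : Diagram) : Link := Quot.mk _ D

/-- The round diagram of the unknot. -/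
def unknot : Diagram where
  events := [.max 0 true, .min 0]
  ne_nil := by simp
  closed := rfl

/-! ## The Conway polynomial -/

/-- `Dp`, `Dm` and `D0` agree outside a disc, in which they are, respectively, a positive
crossing, a negative crossing, and the oriented smoothing of the crossing. The two strands in
the disc run in the same vertical direction `o`, so that `cross i true` is a positive and
`cross i false` a negative crossing and the smoothing just deletes the crossing. -/
def SkeinTriple (Dp Dm D0 : Diagram) : Prop :=
  ∃ (P S : List Event) (i : ℕ) (st : List Bool) (o : Bool),
    run P [] = some st ∧ st[i]? = some o ∧ st[i + 1]? = some o ∧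
    Dp.events = P ++ [.cross i true] ++ S ∧
    Dm.events = P ++ [.cross i false] ++ S ∧
    D0.events = P ++ S

/-- The properties that characterize the Conway polynomial among the functions assigning an
integer polynomial to each oriented link. -/
structure IsConwayPolynomial (f : Link → ℤ[X]) : Prop where
  unknot : f unknot.link = 1
  skein : ∀ Dp Dm D0 : Diagram, SkeinTriple Dp Dm D0 →
    f Dp.link - f Dm.link = X * f D0.link

/-- The Conway polynomial of oriented links: the function on links singled out by
`IsConwayPolynomial`. -/
noncomputable def conway : Link → ℤ[X] :=
  Classical.epsilon IsConwayPolynomial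

/-! ## Braid words and their closures -/

/-- Braid words on `n` strands. The letter `(i, true)` stands for the generator `σ_{i+1}` and
`(i, false)` for its inverse, where `i = 0, ..., n - 2`. -/
abbrev BraidWord (n : ℕ) : Type := List (Fin (n - 1) × Bool)

/-- The nested maxima, the crossings, and the nested minima of the standard diagram of the
closure of a braid word: the `n` strands of the braid run down the page on the left, and the
`n` closing strands run up the page on the right. In `σ_i` the `i`-th strand passes under the
`(i+1)`-st one. -/
def BraidWord.closureEvents {n : ℕ} (w : BraidWord n) : List Event :=
  (List.range n).map (fun k => Event.max k true) ++
    w.map (fun a => Event.cross a.1 a.2) ++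
    (List.range n).reverse.map (fun k => Event.min k)

theorem run_append (l l' : List Event) (st : List Bool) :
    run (l ++ l') st = (run l st).bind (run l') := by
  induction l generalizing st with
  | nil => rfl
  | cons e l ih =>
    simp only [List.cons_append, run]
    cases e.act st with
    | none => rfl
    | some t => exact ih t

theorem run_maxima (n : ℕ) :
    run ((List.range n).map (fun k => Event.max k true)) [] =
      some (List.replicate n true ++ List.replicate n false) := by
  induction n with
  | zero => rfl
  | succ n ih =>
    rw [List.range_succ, List.map_append, run_append, ih]
    rw [List.replicate_succ' (n := n) (a := true), List.replicate_succ (n := n) (a := false)]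
    simp [run, Event.act, Piece.act]

theorem run_minima (n : ℕ) :
    run ((List.range n).reverse.map (fun k => Event.min k))
      (List.replicate n true ++ List.replicate n false) = some [] := by
  induction n with
  | zero => rfl
  | succ n ih =>
    have h : (Event.min n).act (List.replicate (n + 1) true ++ List.replicate (n + 1) false) =
        some (List.replicate n true ++ List.replicate n false) := by
      rw [List.replicate_succ' (n := n) (a := true), List.replicate_succ (n := n) (a := false)]
      simp [Event.act, Piece.act]
    rw [List.range_succ, List.reverse_append, List.map_append]
    simpa [run, h] using ih

theorem run_crossings {n : ℕ} (w : BraidWord n) :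
    run (w.map (fun a => Event.cross a.1 a.2))
      (List.replicate n true ++ List.replicate n false) =
      some (List.replicate n true ++ List.replicate n false) := by
  induction w with
  | nil => rfl
  | cons a w ih =>
    have h : (Event.cross a.1 a.2).act (List.replicate n true ++ List.replicate n false) =
        some (List.replicate n true ++ List.replicate n false) := by
      obtain ⟨⟨i, hi⟩, s⟩ := a
      obtain ⟨k, rfl⟩ : ∃ k, n = i + (k + 2) := ⟨n - i - 2, by omega⟩
      rw [List.replicate_add i (k + 2) true]
      simp [Event.act, Piece.act, List.replicate_succ]
    simpa [run, h] using ih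

/-- The standard diagram of the closure of a braid word on `n ≥ 1` strands. -/
def BraidWord.closure {n : ℕ} (hn : 1 ≤ n) (w : BraidWord n) : Diagram where
  events := w.closureEvents
  ne_nil := by
    have : 0 < w.closureEvents.length := by
      simp only [closureEvents, List.length_append, List.length_map, List.length_range]
      omega
    exact List.ne_nil_of_length_pos this
  closed := by
    rw [closureEvents, run_append, run_append, run_maxima]
    simp only [Option.bind_some, run_crossings, run_minima]

/-- A braid word is homogeneous if for each `i` the generator `σ_i` appears in it if and only if
`σ_i⁻¹` does not. -/
def BraidWord.Homogeneous {n : ℕ} (w : BraidWord n) : Prop :=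
  ∀ i : Fin (n - 1), (i, true) ∈ w ↔ (i, false) ∉ w

/-- For a homogeneous braid word, the sign `α(i)` of the exponent with which the `i`-th
generator appears in it. -/
def BraidWord.exponentSign {n : ℕ} (w : BraidWord n) (i : Fin (n - 1)) : ℤ :=
  if (i, true) ∈ w then 1 else -1

end Knot

/-! `conway` is picked by `Classical.epsilon`, so some function with the two Conway properties must
be shown to exist; afterwards only those properties are used, and uniqueness never enters.

Existence comes from a state sum of gl(1|1) type. Strands carry occupation numbers, and the weights
depend on mutually inverse q and p with q - p = z, so that crossings obey the skein relation.
Amplitudes are invariant under the local moves (`Move.ampEq`), but the two states of a circle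
cancel, so a diagram is cut open at its first maximum. Moving the cut to another maximum changes
nothing because the amplitudes commute with odd symmetries (`ladder_amp`, `cut_swap`).

On closed braids the isotopies yield a Markov trace on the Hecke algebra (`IsConwayTrace`). The
Hecke relations reduce any word to words containing the last generator at most once, without
spoiling a degree bound measured against word length (`DegLE.of_reduced`). On such words the trace
vanishes or destabilizes, whence degree at most m - n + 1 (`IsConwayTrace.degLE`). The same
reduction shows that two occurrences of the last generator with opposite signs cost two degrees
(`degLE_opposite`), and hence that to leading order this generator commutes with the others
(`degLE_commutator`).

In a homogeneous word all occurrences of the last generator have one sign. Two of them can be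
brought together to leading order, and σ² = 1 ± zσ then trades one letter for a factor ±z. Once a
single occurrence is left it is destabilized, and induction on the number of strands gives the
coefficient in degree m - n + 1 (`coeff_homogeneous`). It is a product of signs, so the degree bound
is attained. -/

namespace Knot

/-! ### The state sum: weights, locality, shifting by inert strands -/

section StateSum

variable {A : Type*} [CommRing A] (q p : A)

/-- A strand with its orientation and its occupation number. -/
abbrev Site : Type := Bool × Bool

/-- The eigenvalue of the grouplike element on a site. -/
def kWeight (o x : Bool) : A := (if x then -1 else 1) * (if o then p else q)

/-- Together with `capWeight`: exactly the extrema traversed from left to right carry the grouplike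
weight. A zigzag then has no such extremum or one of each kind, whose weights cancel by qp = 1. -/
def cupWeight (b x : Bool) : A := if b then 1 else kWeight q p false x

def capWeight (a x : Bool) : A := if a then kWeight q p true x else 1

/-- The amplitude for two occupation numbers to be carried through a crossing. -/
def passWeight (s a b x y : Bool) : A :=
  if x = y then
    if s = (a == b) then (if x then -p else q) else (if x then -q else p)
  else 1

/-- The amplitude for the occupation numbers to be exchanged at a crossing. -/
def hopWeight (s a b x y : Bool) : A :=
  if x = (a == s) ∧ y = xor x (a == b) then
    if a = b then (if s then q - p else p - q) else (if x then q - p else p - q)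
  else 0

/-- The operator of a piece at the left end, acting on functions of the sites. -/
def Piece.amp : Piece → (List Site → A) → List Site → A
  | .max b, k, l => cupWeight q p b false * k ((b, false) :: (!b, false) :: l) +
      cupWeight q p b true * k ((b, true) :: (!b, true) :: l)
  | .min, k, (a, x) :: (b, y) :: l => if a = !b ∧ x = y then capWeight q p a x * k l else 0
  | .cross s, k, (a, x) :: (b, y) :: l =>
      passWeight q p s a b x y * k ((b, y) :: (a, x) :: l) +
        hopWeight q p s a b x y * k ((b, xor x (a != b)) :: (a, !x) :: l)
  | _, _, _ => 0

/-- Apply an operator to all but the first `i` sites. -/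
def place (f : (List Site → A) → List Site → A) : ℕ → (List Site → A) → List Site → A
  | 0, k, l => f k l
  | _ + 1, _, [] => 0
  | i + 1, k, s :: l => place f i (fun t => k (s :: t)) l

def amp : List Event → (List Site → A) → List Site → A
  | [], k => k
  | e :: es, k => place (e.piece.amp q p) e.pos (amp es k)

theorem amp_append (L S : List Event) (k : List Site → A) :
    amp q p (L ++ S) k = amp q p L (amp q p S k) := by
  induction L with
  | nil => rfl
  | cons e L ih => simp [amp, ih]

theorem Piece.amp_add (c : Piece) (k k' : List Site → A) (l : List Site) :
    c.amp q p (fun t => k t + k' t) l = c.amp q p k l + c.amp q p k' l := by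
  rcases c with b | _ | s
  · simp only [Piece.amp]; ring
  · rcases l with _ | ⟨⟨a, x⟩, _ | ⟨⟨b, y⟩, l⟩⟩ <;> simp only [Piece.amp, add_zero]
    split_ifs <;> ring
  · rcases l with _ | ⟨⟨a, x⟩, _ | ⟨⟨b, y⟩, l⟩⟩ <;> simp only [Piece.amp, add_zero]
    ring

theorem Piece.amp_mul (c : Piece) (r : A) (k : List Site → A) (l : List Site) :
    c.amp q p (fun t => r * k t) l = r * c.amp q p k l := by
  rcases c with b | _ | s
  · simp only [Piece.amp]; ring
  · rcases l with _ | ⟨⟨a, x⟩, _ | ⟨⟨b, y⟩, l⟩⟩ <;> simp only [Piece.amp, mul_zero]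
    split_ifs <;> ring
  · rcases l with _ | ⟨⟨a, x⟩, _ | ⟨⟨b, y⟩, l⟩⟩ <;> simp only [Piece.amp, mul_zero]
    ring

theorem place_add (c : Piece) (i : ℕ) (k k' : List Site → A) (l : List Site) :
    place (c.amp q p) i (fun t => k t + k' t) l =
      place (c.amp q p) i k l + place (c.amp q p) i k' l := by
  induction i generalizing k k' l with
  | zero => exact c.amp_add q p k k' l
  | succ i ih =>
    cases l with
    | nil => simp [place]
    | cons s l => exact ih _ _ l

theorem place_mul (c : Piece) (i : ℕ) (r : A) (k : List Site → A) (l : List Site) :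
    place (c.amp q p) i (fun t => r * k t) l = r * place (c.amp q p) i k l := by
  induction i generalizing k l with
  | zero => exact c.amp_mul q p r k l
  | succ i ih =>
    cases l with
    | nil => simp [place]
    | cons s l => exact ih _ l

theorem place_zero (c : Piece) (i : ℕ) (l : List Site) :
    place (c.amp q p) i (fun _ => 0) l = 0 := by
  simpa using place_mul q p c i 0 (fun _ => 0) l

theorem Event.act_succ_cons (c : Piece) (i : ℕ) (o : Bool) (st : List Bool) :
    Event.act ⟨c, i + 1⟩ (o :: st) = (Event.act ⟨c, i⟩ st).map (o :: ·) := by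
  simp only [Event.act, List.length_cons, Nat.add_le_add_iff_right, List.drop_succ_cons,
    List.take_succ_cons]
  split_ifs <;> simp [Function.comp_def]

theorem Event.act_succ_nil (c : Piece) (i : ℕ) : Event.act ⟨c, i + 1⟩ [] = none := by
  simp [Event.act]

theorem Event.act_zero (c : Piece) (st : List Bool) : Event.act ⟨c, 0⟩ st = c.act st := by
  simp [Event.act]

abbrev orient (l : List Site) : List Bool := l.map Prod.fst

theorem Piece.amp_congr (c : Piece) {k k' : List Site → A} (l : List Site)
    (h : ∀ t, c.act (orient l) = some (orient t) → k t = k' t) :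
    c.amp q p k l = c.amp q p k' l := by
  rcases c with b | _ | s
  · simp only [Piece.amp]
    rw [h _ (by simp [Piece.act]), h _ (by simp [Piece.act])]
  · rcases l with _ | ⟨⟨a, x⟩, _ | ⟨⟨b, y⟩, l⟩⟩ <;> simp only [Piece.amp]
    split_ifs with hab
    · rw [h _ (by simp [Piece.act, hab.1])]
    · rfl
  · rcases l with _ | ⟨⟨a, x⟩, _ | ⟨⟨b, y⟩, l⟩⟩ <;> simp only [Piece.amp]
    rw [h _ (by simp [Piece.act]), h _ (by simp [Piece.act])]

theorem place_congr (c : Piece) (i : ℕ) {k k' : List Site → A} (l : List Site)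
    (h : ∀ t, Event.act ⟨c, i⟩ (orient l) = some (orient t) → k t = k' t) :
    place (c.amp q p) i k l = place (c.amp q p) i k' l := by
  induction i generalizing k k' l with
  | zero => exact c.amp_congr q p l fun t ht => h t (by rwa [Event.act_zero])
  | succ i ih =>
    cases l with
    | nil => rfl
    | cons s l =>
      refine ih l fun t ht => h _ ?_
      simp [orient, Event.act_succ_cons] at ht ⊢
      exact ht

/-- The orientations below `P` are determined by those above, so identities that hold only for
suitably oriented strands can be applied underneath `P`. -/
theorem amp_congr (P : List Event) {k k' : List Site → A} (l : List Site)
    (h : ∀ t, run P (orient l) = some (orient t) → k t = k' t) :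
    amp q p P k l = amp q p P k' l := by
  induction P generalizing l with
  | nil => exact h l rfl
  | cons e P ih =>
    refine place_congr q p _ _ l fun t ht => ih t fun u hu => h u ?_
    have : e.act (orient l) = some (orient t) := ht
    simpa [run, this] using hu

/-- The events after one strand has been added on the left. -/
def Event.shift (e : Event) : Event := ⟨e.piece, e.pos + 1⟩

theorem amp_shift (L : List Event) (k : List Site → A) (s : Site) (l : List Site) :
    amp q p (L.map Event.shift) k (s :: l) = amp q p L (fun t => k (s :: t)) l := by
  induction L generalizing l with
  | nil => rfl
  | cons e L ih =>
    simp only [List.map_cons, amp, Event.shift, place]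
    congr 1
    exact funext ih

theorem run_shift (L : List Event) (o : Bool) (st : List Bool) :
    run (L.map Event.shift) (o :: st) = (run L st).map (o :: ·) := by
  induction L generalizing st with
  | nil => rfl
  | cons e L ih =>
    obtain ⟨c, i⟩ := e
    simp only [List.map_cons, run, Event.shift, Event.act_succ_cons]
    cases Event.act ⟨c, i⟩ st with
    | none => rfl
    | some t => exact ih t

/-- Two sequences of levels have the same amplitudes wherever both make sense. -/
def AmpEq (L L' : List Event) : Prop :=
  ∀ (k : List Site → A) (l : List Site), run L (orient l) ≠ none → run L' (orient l) ≠ none →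
    amp q p L k l = amp q p L' k l

theorem run_shift_nil {L : List Event} (hL : L ≠ []) : run (L.map Event.shift) [] = none := by
  obtain ⟨e, L, rfl⟩ := List.exists_cons_of_ne_nil hL
  simp [run, Event.shift, Event.act_succ_nil]

variable {q p}

theorem AmpEq.shift {L L' : List Event} (hL : L ≠ []) (h : AmpEq q p L L') :
    AmpEq q p (L.map Event.shift) (L'.map Event.shift) := by
  intro k l h1 h2
  cases l with
  | nil => simp [run_shift_nil hL] at h1
  | cons s l =>
    rw [amp_shift, amp_shift]
    apply h
    · intro h0; apply h1; simp only [orient, List.map_cons, run_shift]; simp [orient] at h0; simp [h0]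
    · intro h0; apply h2; simp only [orient, List.map_cons, run_shift]; simp [orient] at h0; simp [h0]

/-- Strands to the left of a piece are inert, so each local move need only be checked at the left
end, on finitely many sites. Nonemptiness of `L i` guarantees that the shifted sequence has a
leftmost strand to peel off. -/
theorem ampEq_of_zero {L L' : ℕ → List Event} (h0 : AmpEq q p (L 0) (L' 0))
    (hne : ∀ i, L i ≠ []) (hL : ∀ i, L (i + 1) = (L i).map Event.shift)
    (hL' : ∀ i, L' (i + 1) = (L' i).map Event.shift) (i : ℕ) : AmpEq q p (L i) (L' i) := by
  induction i with
  | zero => exact h0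
  | succ i ih => rw [hL, hL']; exact ih.shift (hne i)

/-- The two operators act on disjoint sets of sites; what remains is that the right one is linear in
its continuation. -/
theorem ampEq_exchange_zero (c d : Piece) (j : ℕ) :
    AmpEq q p [⟨c, 0⟩, ⟨d, j + c.numOut⟩] [⟨d, j + c.numIn⟩, ⟨c, 0⟩] := by
  intro k l h1 h2
  simp only [amp, place]
  rcases c with b | _ | s
  · simp only [Piece.amp, Piece.numIn, Piece.numOut, place, add_zero]
    rw [place_add, place_mul, place_mul]
  · rcases l with _ | ⟨⟨a, x⟩, _ | ⟨⟨b, y⟩, l⟩⟩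
    · simp [Piece.numIn, place, Piece.amp]
    · simp [Piece.numIn, place, Piece.amp]
    · simp only [Piece.amp, Piece.numIn, Piece.numOut, place, add_zero]
      split_ifs with h
      · rw [place_mul]
      · rw [place_zero]
  · rcases l with _ | ⟨⟨a, x⟩, _ | ⟨⟨b, y⟩, l⟩⟩
    · simp [Piece.numIn, place, Piece.amp]
    · simp [Piece.numIn, place, Piece.amp]
    · simp only [Piece.amp, Piece.numIn, Piece.numOut, place]
      rw [place_add, place_mul, place_mul]

theorem ampEq_exchange (c d : Piece) (i j : ℕ) (h : i ≤ j) :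
    AmpEq q p [⟨c, i⟩, ⟨d, j + c.numOut⟩] [⟨d, j + c.numIn⟩, ⟨c, i⟩] := by
  obtain ⟨j, rfl⟩ := Nat.exists_eq_add_of_le' h
  refine ampEq_of_zero (L := fun i => [⟨c, i⟩, ⟨d, j + i + c.numOut⟩])
    (L' := fun i => [⟨d, j + i + c.numIn⟩, ⟨c, i⟩]) (ampEq_exchange_zero c d j) (by simp) ?_ ?_ i
  · intro i; simp [Event.shift]; omega
  · intro i; simp [Event.shift]; omega

end StateSum

/-! ### Invariance under each local move, by enumeration of local states -/

section LocalMoves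

variable {A : Type*} [CommRing A] {q p : A}

theorem ampEq_zigzagRight (h : q * p = 1) (b : Bool) :
    AmpEq q p [.max 1 b, .min 0] [] := by
  rintro k (_ | ⟨⟨o, x⟩, l⟩) h1 -
  · simp [run, Event.act] at h1
  · cases b <;> cases o <;> cases x <;>
      simp [run, Event.act, Piece.act, amp, place, Piece.amp, cupWeight, capWeight, kWeight] at h1 ⊢ <;>
      grind

theorem ampEq_zigzagLeft (h : q * p = 1) (b : Bool) :
    AmpEq q p [.max 0 b, .min 1] [] := by
  rintro k (_ | ⟨⟨o, x⟩, l⟩) h1 -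
  · simp [run, Event.act, Piece.act] at h1
  · cases b <;> cases o <;> cases x <;>
      simp [run, Event.act, Piece.act, amp, place, Piece.amp, cupWeight, capWeight, kWeight] at h1 ⊢ <;>
      grind

theorem ampEq_slideMax (b s : Bool) :
    AmpEq q p [.max 0 b, .cross 1 s] [.max 1 b, .cross 0 (!s)] := by
  rintro k (_ | ⟨⟨o, x⟩, l⟩) h1 -
  · simp [run, Event.act, Piece.act] at h1
  · cases b <;> cases s <;> cases o <;> cases x <;>
      simp [amp, place, Piece.amp, cupWeight, kWeight, passWeight, hopWeight] <;>
      grind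

theorem ampEq_slideMin (s : Bool) :
    AmpEq q p [.cross 1 s, .min 0] [.cross 0 (!s), .min 1] := by
  rintro k (_ | ⟨⟨a, x⟩, _ | ⟨⟨b, y⟩, _ | ⟨⟨c, w⟩, l⟩⟩⟩) h1 -
  · simp [run, Event.act, Piece.act] at h1
  · simp [run, Event.act, Piece.act] at h1
  · simp [run, Event.act, Piece.act] at h1
  · cases s <;> cases a <;> cases b <;> cases c <;> cases x <;> cases y <;> cases w <;>
      simp [amp, place, Piece.amp, capWeight, kWeight, passWeight, hopWeight] <;>
      grind

theorem ampEq_reidemeister1Right (h : q * p = 1) (b s : Bool) :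
    AmpEq q p [.max 1 b, .cross 0 s, .min 1] [] := by
  rintro k (_ | ⟨⟨o, x⟩, l⟩) h1 -
  · simp [run, Event.act, Piece.act] at h1
  · cases b <;> cases s <;> cases o <;> cases x <;>
      simp [run, Event.act, Piece.act, amp, place, Piece.amp, cupWeight, capWeight, kWeight,
        passWeight, hopWeight] at h1 ⊢ <;>
      grind

theorem ampEq_reidemeister1Left (h : q * p = 1) (b s : Bool) :
    AmpEq q p [.max 0 b, .cross 1 s, .min 0] [] := by
  rintro k (_ | ⟨⟨o, x⟩, l⟩) h1 -
  · simp [run, Event.act, Piece.act] at h1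
  · cases b <;> cases s <;> cases o <;> cases x <;>
      simp [run, Event.act, Piece.act, amp, place, Piece.amp, cupWeight, capWeight, kWeight,
        passWeight, hopWeight] at h1 ⊢ <;>
      grind

theorem ampEq_reidemeister2 (h : q * p = 1) (s : Bool) :
    AmpEq q p [.cross 0 s, .cross 0 (!s)] [] := by
  rintro k (_ | ⟨⟨a, x⟩, _ | ⟨⟨b, y⟩, l⟩⟩) h1 -
  · simp [run, Event.act, Piece.act] at h1
  · simp [run, Event.act, Piece.act] at h1
  · cases s <;> cases a <;> cases b <;> cases x <;> cases y <;>
      simp [amp, place, Piece.amp, passWeight, hopWeight] <;>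
      grind

set_option maxHeartbeats 4000000 in
-- The Yang–Baxter equation, checked for all orientations and occupations of three strands.
theorem ampEq_reidemeister3 (h : q * p = 1) (s : Bool) :
    AmpEq q p [.cross 0 s, .cross 1 s, .cross 0 s] [.cross 1 s, .cross 0 s, .cross 1 s] := by
  rintro k (_ | ⟨⟨a, x⟩, _ | ⟨⟨b, y⟩, _ | ⟨⟨c, w⟩, l⟩⟩⟩) h1 -
  · simp [run, Event.act, Piece.act] at h1
  · simp [run, Event.act, Piece.act] at h1
  · simp [run, Event.act, Piece.act] at h1
  · cases s <;> cases a <;> cases b <;> cases c <;> cases x <;> cases y <;> cases w <;>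
      simp [amp, place, Piece.amp, passWeight, hopWeight] <;>
      grind

end LocalMoves

/-! ### Odd symmetries and independence of the cut -/

section Symmetry

variable {A : Type*} [CommRing A] (q p r : A)

def ladderWeight (o x : Bool) : A :=
  if o then (if x then r else 1) else (if x then q else -(r * q))

/-- The action of a pencil of odd elements of the quantum group on functions of the sites. -/
def ladder : (List Site → A) → List Site → A
  | _, [] => 0
  | k, (o, x) :: l => ladderWeight q r o x * k ((o, !x) :: l) +
      kWeight q p o x * ladder (fun t => k ((o, x) :: t)) l

theorem ladder_add (k k' : List Site → A) (l : List Site) :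
    ladder q p r (fun t => k t + k' t) l = ladder q p r k l + ladder q p r k' l := by
  induction l generalizing k k' with
  | nil => simp [ladder]
  | cons s l ih =>
    obtain ⟨o, x⟩ := s
    simp only [ladder, ih]
    ring

theorem ladder_mul (c : A) (k : List Site → A) (l : List Site) :
    ladder q p r (fun t => c * k t) l = c * ladder q p r k l := by
  induction l generalizing k with
  | nil => simp [ladder]
  | cons s l ih =>
    obtain ⟨o, x⟩ := s
    simp only [ladder, ih]
    ring

theorem ladder_neg (k : List Site → A) (l : List Site) :
    ladder q p r (fun t => -k t) l = -ladder q p r k l := by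
  simpa using ladder_mul q p r (-1) k l

theorem ladder_zero (l : List Site) : ladder q p r (fun _ => 0) l = 0 := by
  simpa using ladder_mul q p r 0 (fun _ => 0) l

variable {q p}

/-- Each elementary piece intertwines the odd symmetries. Sites on which the piece does not fit are
excluded, since amplitudes there are only default values. -/
theorem Piece.ladder_amp (h : q * p = 1) (c : Piece) (k : List Site → A) (l : List Site)
    (hl : c.act (orient l) ≠ none) :
    ladder q p r (c.amp q p k) l = c.amp q p (ladder q p r k) l := by
  rcases c with b | _ | s
  · have e : Piece.amp q p (.max b) k = fun l =>
        cupWeight q p b false * k ((b, false) :: (!b, false) :: l) +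
        cupWeight q p b true * k ((b, true) :: (!b, true) :: l) := by
      funext l; simp only [Piece.amp]
    rw [e, ladder_add, ladder_mul, ladder_mul]
    cases b <;> simp [Piece.amp, ladder, cupWeight, kWeight, ladderWeight] <;> grind
  · rcases l with _ | ⟨⟨a, x⟩, _ | ⟨⟨b, y⟩, l⟩⟩
    · simp [Piece.act] at hl
    · simp [Piece.act] at hl
    · obtain rfl : a = !b := by
        by_contra hab
        simp [Piece.act, hab] at hl
      cases b <;> cases x <;> cases y <;>
        simp [Piece.amp, ladder, capWeight, kWeight, ladderWeight, ladder_zero, ladder_mul, ladder_neg] <;> grind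
  · rcases l with _ | ⟨⟨a, x⟩, _ | ⟨⟨b, y⟩, l⟩⟩
    · simp [Piece.act] at hl
    · simp [Piece.act] at hl
    · cases s <;> cases a <;> cases b <;> cases x <;> cases y <;>
        simp [Piece.amp, ladder, kWeight, ladderWeight, passWeight, hopWeight, ladder_add,
          ladder_mul, ladder_neg] <;>
        grind

theorem ladder_place (h : q * p = 1) (c : Piece) (i : ℕ) (k : List Site → A) (l : List Site)
    (hl : Event.act ⟨c, i⟩ (orient l) ≠ none) :
    ladder q p r (place (c.amp q p) i k) l = place (c.amp q p) i (ladder q p r k) l := by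
  induction i generalizing k l with
  | zero => exact c.ladder_amp r h k l (by rwa [Event.act_zero] at hl)
  | succ i ih =>
    rcases l with _ | ⟨⟨o, x⟩, l⟩
    · simp [Event.act_succ_nil] at hl
    · have hl' : Event.act ⟨c, i⟩ (orient l) ≠ none := by
        intro h0
        simp only [orient, List.map_cons, Event.act_succ_cons] at hl h0
        simp [h0] at hl
      have := ih (fun t => k ((o, x) :: t)) l hl'
      simp only [ladder, place]
      rw [place_add, place_mul, place_mul, this]

theorem ladder_amp (h : q * p = 1) (S : List Event) (k : List Site → A) (l : List Site)
    (hl : run S (orient l) ≠ none) :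
    ladder q p r (amp q p S k) l = amp q p S (ladder q p r k) l := by
  induction S generalizing l with
  | nil => rfl
  | cons e S ih =>
    have he : e.act (orient l) ≠ none := by
      intro h0; simp [run, h0] at hl
    simp only [amp]
    rw [ladder_place r h _ _ _ _ he]
    refine place_congr q p _ _ l fun t ht => ih t ?_
    have : e.act (orient l) = some (orient t) := ht
    simpa [run, this] using hl

theorem amp_add (P : List Event) (k k' : List Site → A) (l : List Site) :
    amp q p P (fun t => k t + k' t) l = amp q p P k l + amp q p P k' l := by
  induction P generalizing l with
  | nil => rfl
  | cons e P ih =>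
    simp only [amp]
    rw [← place_add]
    congr 1
    exact funext ih

theorem amp_mul (P : List Event) (c : A) (k : List Site → A) (l : List Site) :
    amp q p P (fun t => c * k t) l = c * amp q p P k l := by
  induction P generalizing l with
  | nil => rfl
  | cons e P ih =>
    simp only [amp]
    rw [← place_mul]
    congr 1
    exact funext ih

/-- The vacuum functional: the indicator function of the empty list of sites. -/
def vacuum (l : List Site) : A := if l = [] then 1 else 0

theorem ladder_vacuum : ladder q p r vacuum = fun _ => (0 : A) := by
  funext l
  rcases l with _ | ⟨⟨o, x⟩, l⟩
  · rfl
  · simp [ladder, ladder_zero, vacuum]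

theorem ladder_amp_vacuum (h : q * p = 1) (S : List Event) (l : List Site)
    (hl : run S (orient l) ≠ none) : ladder q p r (amp q p S vacuum) l = 0 := by
  rw [ladder_amp r h S _ l hl, ladder_vacuum]
  simpa using amp_mul (q := q) (p := p) S 0 (fun _ => 0) l

variable (q p) in
/-- The amplitude of a diagram cut open at its first maximum. -/
def stateSum : List Event → A
  | ⟨.max b, _⟩ :: S =>
    (if b then q else 1) * amp q p S vacuum [(b, false), (!b, false)]
  | _ => 0

/-- The two sides cut open different maxima. The amplitude below, as a function of the four sites,
is annihilated by every `ladder`: r = 0 isolates one odd generator, and the difference of r = 1 and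
r = 0 the other. Evaluated at states with one occupied site, these relations combine linearly to the
claim. -/
theorem cut_swap (h : q * p = 1) (S : List Event) (b b' : Bool)
    (hS : run S [b, !b, b', !b'] ≠ none) :
    stateSum q p (.max 0 b :: .max 2 b' :: S) = stateSum q p (.max 0 b' :: .max 0 b :: S) := by
  have key : ∀ (r : A) (x y z w : Bool),
      ladder q p r (amp q p S vacuum) [(b, x), (!b, y), (b', z), (!b', w)] = 0 :=
    fun r x y z w => ladder_amp_vacuum r h S _ hS
  simp only [stateSum, amp, place, Piece.amp]
  generalize amp q p S vacuum = G at key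
  cases b <;> cases b' <;> simp [cupWeight, kWeight]
  · have h1 := key 0 false false true false
    have h2 := key 0 false true false false
    have h3 := key 1 false true false false
    simp [kWeight, ladder, ladderWeight] at h1 h2 h3
    grind
  · have h1 := key 0 false false false true
    have h2 := key 0 false true false false
    have h3 := key 1 false true false false
    simp [kWeight, ladder, ladderWeight] at h1 h2 h3
    grind
  · have h1 := key 0 false true false false
    have h2 := key 0 false false false true
    have h3 := key 1 false false false true
    simp [kWeight, ladder, ladderWeight] at h1 h2 h3
    grind
  · have h1 := key 0 false false false true
    have h2 := key 0 true false false false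
    have h3 := key 1 true false false false
    simp [kWeight, ladder, ladderWeight] at h1 h2 h3
    grind

end Symmetry

/-! ### The cut state sum is a link invariant with the skein relation -/

section Existence

variable {A : Type*} [CommRing A] {q p : A}

theorem Move.ampEq (h : q * p = 1) {L L' : List Event} (m : Move L L') :
    AmpEq q p L L' := by
  cases m with
  | exchange c d i j hij => exact ampEq_exchange c d i j hij
  | zigzagRight i b =>
    exact ampEq_of_zero (L := fun i => [.max (i + 1) b, .min i]) (L' := fun _ => [])
      (ampEq_zigzagRight h b) (by simp) (fun _ => rfl) (fun _ => rfl) i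
  | zigzagLeft i b =>
    exact ampEq_of_zero (L := fun i => [.max i b, .min (i + 1)]) (L' := fun _ => [])
      (ampEq_zigzagLeft h b) (by simp) (fun _ => rfl) (fun _ => rfl) i
  | slideMax i b s =>
    exact ampEq_of_zero (L := fun i => [.max i b, .cross (i + 1) s])
      (L' := fun i => [.max (i + 1) b, .cross i (!s)])
      (ampEq_slideMax b s) (by simp) (fun _ => rfl) (fun _ => rfl) i
  | slideMin i s =>
    exact ampEq_of_zero (L := fun i => [.cross (i + 1) s, .min i])
      (L' := fun i => [.cross i (!s), .min (i + 1)])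
      (ampEq_slideMin s) (by simp) (fun _ => rfl) (fun _ => rfl) i
  | reidemeister1Right i b s =>
    exact ampEq_of_zero (L := fun i => [.max (i + 1) b, .cross i s, .min (i + 1)])
      (L' := fun _ => [])
      (ampEq_reidemeister1Right h b s) (by simp) (fun _ => rfl) (fun _ => rfl) i
  | reidemeister1Left i b s =>
    exact ampEq_of_zero (L := fun i => [.max i b, .cross (i + 1) s, .min i])
      (L' := fun _ => [])
      (ampEq_reidemeister1Left h b s) (by simp) (fun _ => rfl) (fun _ => rfl) i
  | reidemeister2 i s =>
    exact ampEq_of_zero (L := fun i => [.cross i s, .cross i (!s)]) (L' := fun _ => [])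
      (ampEq_reidemeister2 h s) (by simp) (fun _ => rfl) (fun _ => rfl) i
  | reidemeister3 i s =>
    exact ampEq_of_zero (L := fun i => [.cross i s, .cross (i + 1) s, .cross i s])
      (L' := fun i => [.cross (i + 1) s, .cross i s, .cross (i + 1) s])
      (ampEq_reidemeister3 h s) (by simp) (fun _ => rfl) (fun _ => rfl) i

theorem AmpEq.context {L L' : List Event} (h : AmpEq q p L L') (P S : List Event)
    (k : List Site → A) (l : List Site) (h1 : run (P ++ L ++ S) (orient l) ≠ none)
    (h2 : run (P ++ L' ++ S) (orient l) ≠ none) :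
    amp q p (P ++ L ++ S) k l = amp q p (P ++ L' ++ S) k l := by
  rw [List.append_assoc, run_append] at h1 h2
  simp only [List.append_assoc]
  rw [amp_append, amp_append q p P]
  refine amp_congr q p P l fun t ht => ?_
  rw [ht, Option.bind_some, run_append] at h1 h2
  rw [amp_append, amp_append]
  exact h _ t (fun h0 => h1 (by rw [h0]; rfl)) (fun h0 => h2 (by rw [h0]; rfl))

theorem Event.act_nil {e : Event} {st : List Bool} (h : e.act [] = some st) :
    ∃ b, e = .max 0 b ∧ st = [b, !b] := by
  obtain ⟨c, i⟩ := e
  rcases i with _ | i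
  · rcases c with b | _ | s <;> simp [Event.act, Piece.act] at h ⊢
    exact h.symm
  · simp [Event.act] at h

/-- At the very top there are no strands, so the only move that fits on both sides is the exchange
of two maxima; this is the one move that changes where the diagram is cut. -/
theorem Move.stateSum_eq (h : q * p = 1) {L L' : List Event} (m : Move L L') (S : List Event)
    (h1 : run (L ++ S) [] ≠ none) (h2 : run (L' ++ S) [] ≠ none) :
    stateSum q p (L ++ S) = stateSum q p (L' ++ S) := by
  cases m with
  | exchange c d i j hij =>
    simp only [List.cons_append, List.nil_append, run] at h1 h2 ⊢
    rcases hc : Event.act ⟨c, i⟩ [] with _ | st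
    · simp [hc] at h1
    · obtain ⟨b, hb, rfl⟩ := Event.act_nil hc
      obtain ⟨rfl, rfl⟩ : c = .max b ∧ i = 0 := by simpa using hb
      rcases hd : Event.act ⟨d, j⟩ [] with _ | st
      · simp [Piece.numIn, hd] at h2
      · obtain ⟨b', hb', rfl⟩ := Event.act_nil hd
        obtain ⟨rfl, rfl⟩ : d = .max b' ∧ j = 0 := by simpa using hb'
        refine cut_swap h S b b' ?_
        simpa [Event.act, Piece.act, Piece.numOut] using h1
  | reidemeister2 i s => simp [run, Event.act, Piece.act] at h1
  | reidemeister3 i s => simp [run, Event.act, Piece.act] at h1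
  | slideMin i s => simp [run, Event.act, Piece.act] at h1
  | slideMax i b s => simp [run, Event.act, Piece.act] at h2
  | zigzagRight i b => simp [run, Event.act, Piece.act] at h1
  | zigzagLeft i b =>
    rcases i with _ | i <;> simp [run, Event.act, Piece.act] at h1
  | reidemeister1Right i b s => simp [run, Event.act, Piece.act] at h1
  | reidemeister1Left i b s =>
    rcases i with _ | i <;> simp [run, Event.act, Piece.act] at h1

theorem Diagram.Step.stateSum_eq (h : q * p = 1) {D D' : Diagram} (hD : D.Step D') :
    stateSum q p D.events = stateSum q p D'.events := by
  obtain ⟨P, S, L, L', m, e, e'⟩ := hD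
  have c1 := D.closed
  have c2 := D'.closed
  rw [e] at c1 ⊢
  rw [e'] at c2 ⊢
  rcases P with _ | ⟨a, P⟩
  · exact m.stateSum_eq h S (by simpa using congrArg (· ≠ none) c1)
      (by simpa using congrArg (· ≠ none) c2)
  · simp only [List.cons_append, run] at c1 c2 ⊢
    rcases ha : a.act [] with _ | st
    · simp [ha] at c1
    · obtain ⟨b, rfl, rfl⟩ := Event.act_nil ha
      rw [ha, Option.bind_some] at c1 c2
      simp only [stateSum]
      rw [(m.ampEq h).context P S]
      · exact fun h0 => by simp [orient, -List.append_assoc, c1] at h0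
      · exact fun h0 => by simp [orient, -List.append_assoc, c2] at h0

/-- The quadratic relation of the R-matrix: on parallel strands the positive and the negative
crossing differ by q - p times the identity. -/
theorem place_cross_sub (i : ℕ) (k : List Site → A) (l : List Site) (o : Bool)
    (h1 : (orient l)[i]? = some o) (h2 : (orient l)[i + 1]? = some o) :
    place ((Piece.cross true).amp q p) i k l =
      place ((Piece.cross false).amp q p) i k l + (q - p) * k l := by
  induction i generalizing k l with
  | zero =>
    rcases l with _ | ⟨⟨a, x⟩, _ | ⟨⟨b, y⟩, l⟩⟩
    · simp at h1
    · simp at h2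
    · obtain rfl : a = o := by simpa using h1
      obtain rfl : b = a := by simpa using h2
      cases b <;> cases x <;> cases y <;>
        simp [place, Piece.amp, passWeight, hopWeight] <;> ring
  | succ i ih =>
    rcases l with _ | ⟨s, l⟩
    · simp at h1
    · exact ih _ l (by simpa using h1) (by simpa using h2)

theorem SkeinTriple.stateSum_sub {Dp Dm D0 : Diagram} (h : SkeinTriple Dp Dm D0) :
    stateSum q p Dp.events - stateSum q p Dm.events = (q - p) * stateSum q p D0.events := by
  obtain ⟨P, S, i, st, o, hP, h1, h2, ep, em, e0⟩ := h
  rw [ep, em, e0]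
  rcases P with _ | ⟨a, P⟩
  · obtain rfl : [] = st := by simpa [run] using hP
    simp at h1
  · simp only [List.cons_append, run] at hP ⊢
    rcases ha : a.act [] with _ | st'
    · simp [ha] at hP
    · obtain ⟨b, rfl, rfl⟩ := Event.act_nil ha
      rw [ha, Option.bind_some] at hP
      have key : amp q p (P ++ [.cross i true] ++ S) vacuum [(b, false), (!b, false)] =
          amp q p (P ++ [.cross i false] ++ S) vacuum [(b, false), (!b, false)] +
            (q - p) * amp q p (P ++ S) vacuum [(b, false), (!b, false)] := by
        simp only [List.append_assoc, amp_append]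
        rw [← amp_mul, ← amp_add]
        refine amp_congr q p P _ fun t ht => ?_
        have hst : st = orient t := by simpa [orient, hP] using ht
        subst hst
        exact place_cross_sub i _ t o h1 h2
      simp only [stateSum]
      simp only [List.append_assoc, List.cons_append, List.nil_append] at key ⊢
      rw [key]
      ring

end Existence

open QuadraticAlgebra in
/-- The Conway polynomial as a state sum: the amplitudes take values in `ℤ[z][q] / (q² - zq - 1)`,
which retracts to `ℤ[z]`. -/
theorem exists_isConwayPolynomial : ∃ f : Link → ℤ[X], IsConwayPolynomial f := by
  let q : QuadraticAlgebra ℤ[X] 1 X := ⟨0, 1⟩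
  -- This is q - z, the inverse of q because q² = zq + 1.
  let p : QuadraticAlgebra ℤ[X] 1 X := ⟨-X, 1⟩
  have hqp : q * p = 1 := by
    ext1 <;> simp [q, p]
  have hz : q - p = ⟨X, 0⟩ := by
    ext1 <;> simp [q, p]
  -- `re` is ℤ[z]-linear and sends 1 to 1, so both axioms pass to ℤ[z].
  refine ⟨Quot.lift (fun D => (stateSum q p D.events).re)
    fun D D' h => congrArg _ (h.stateSum_eq hqp), ?_, ?_⟩
  · have : stateSum q p unknot.events = 1 := by
      simp [unknot, stateSum, amp, place, Piece.amp, vacuum, capWeight, kWeight, hqp]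
    exact congrArg QuadraticAlgebra.re this
  · intro Dp Dm D0 h
    have := congrArg QuadraticAlgebra.re (h.stateSum_sub (q := q) (p := p))
    rw [hz] at this
    exact Eq.trans (by simp [Diagram.link]) (this.trans (by simp [Diagram.link]))

theorem isConwayPolynomial_conway : IsConwayPolynomial conway :=
  Classical.epsilon_spec exists_isConwayPolynomial

/-! ## Isotopies of closed braids -/

/-- Two sequences of levels below the strands `st` that can be replaced by one another in any
diagram. -/
def Isotopic (st : List Bool) (L L' : List Event) : Prop :=
  run L st = run L' st ∧ ∀ (P S : List Event) (D D' : Diagram),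
    run P [] = some st → D.events = P ++ L ++ S → D'.events = P ++ L' ++ S → D.link = D'.link

namespace Isotopic

variable {st : List Bool} {L L' L'' : List Event}

theorem refl (st : List Bool) (L : List Event) : Isotopic st L L :=
  ⟨rfl, fun _ _ _ _ _ h h' => congrArg _ (Diagram.ext (h.trans h'.symm))⟩

theorem symm (h : Isotopic st L L') : Isotopic st L' L :=
  ⟨h.1.symm, fun P S D D' hP e e' => (h.2 P S D' D hP e' e).symm⟩

/-- The intermediate diagram must be an actual `Diagram`, hence have a nonempty list of events;
requiring `L'` to be nonempty ensures this. -/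
theorem trans (h : Isotopic st L L') (h' : Isotopic st L' L'')
    (hL' : L' ≠ [] := by simp) : Isotopic st L L'' := by
  refine ⟨h.1.trans h'.1, fun P S D D'' hP e e'' => ?_⟩
  have hD := D.closed
  rw [e, List.append_assoc, run_append, hP, Option.bind_some, run_append, h.1] at hD
  let D' : Diagram :=
    { events := P ++ L' ++ S
      ne_nil := by simp [hL']
      closed := by rwa [List.append_assoc, run_append, hP, Option.bind_some, run_append] }
  exact (h.2 P S D D' hP e rfl).trans (h'.2 P S D' D'' hP rfl e'')

theorem of_move (m : Move L L') (h : run L st = run L' st) : Isotopic st L L' :=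
  ⟨h, fun P S _ _ _ e e' => Quot.sound ⟨P, S, L, L', m, e, e'⟩⟩

theorem context {st' : List Bool} (h : Isotopic st' L L') (P S : List Event)
    (hP : run P st = some st') : Isotopic st (P ++ L ++ S) (P ++ L' ++ S) := by
  refine ⟨?_, fun P' S' D D' hP' e e' => h.2 (P' ++ P) (S ++ S') D D' ?_ ?_ ?_⟩
  · rw [List.append_assoc, List.append_assoc, run_append, run_append, hP, Option.bind_some,
      Option.bind_some, run_append, run_append, h.1]
  · rw [run_append, hP', Option.bind_some, hP]
  · simpa using e
  · simpa using e'

theorem append_left {st' : List Bool} (h : Isotopic st' L L') (P : List Event)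
    (hP : run P st = some st') : Isotopic st (P ++ L) (P ++ L') := by
  simpa using h.context P [] hP

theorem append_right (h : Isotopic st L L') (S : List Event) :
    Isotopic st (L ++ S) (L' ++ S) := by
  simpa using h.context [] S rfl

end Isotopic

/-- The strands of a closed braid at the height of the braid. -/
def braidStrands (n : ℕ) : List Bool := List.replicate n true ++ List.replicate n false

def maxima (n : ℕ) : List Event := (List.range n).map fun k => Event.max k true

def minima (n : ℕ) : List Event := (List.range n).reverse.map fun k => Event.min k

theorem run_maxima' (n : ℕ) : run (maxima n) [] = some (braidStrands n) := run_maxima n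

theorem run_minima' (n : ℕ) : run (minima n) (braidStrands n) = some [] := run_minima n

theorem maxima_succ (n : ℕ) : maxima (n + 1) = maxima n ++ [.max n true] := by
  simp [maxima, List.range_succ]

theorem minima_succ (n : ℕ) : minima (n + 1) = .min n :: minima n := by
  simp [minima, List.range_succ]

theorem Event.act_append (c : Piece) (k : ℕ) (l r : List Bool) :
    Event.act ⟨c, l.length + k⟩ (l ++ r) = (Event.act ⟨c, k⟩ r).map (l ++ ·) := by
  induction l with
  | nil => simp
  | cons o l ih =>
    have : (o :: l).length + k = (l.length + k) + 1 := by simp; omega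
    rw [this, List.cons_append, Event.act_succ_cons, ih, Option.map_map]
    rfl

theorem run_cross_of_getElem? {st : List Bool} {i : ℕ} {o : Bool} (s : Bool)
    (h1 : st[i]? = some o) (h2 : st[i + 1]? = some o) : run [.cross i s] st = some st := by
  induction i generalizing st with
  | zero =>
    rcases st with _ | ⟨a, _ | ⟨b, st⟩⟩
    · simp at h1
    · simp at h2
    · obtain rfl : a = o := by simpa using h1
      obtain rfl : b = a := by simpa using h2
      simp [run, Event.act, Piece.act]
  | succ i ih =>
    rcases st with _ | ⟨a, st⟩
    · simp at h1
    · have := ih (st := st) (by simpa using h1) (by simpa using h2)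
      have h := run_shift [.cross i s] a st
      rw [this] at h
      exact h

theorem getElem?_braidStrands_left {n i : ℕ} (h : i < n) : (braidStrands n)[i]? = some true := by
  rw [braidStrands, List.getElem?_append_left (by simpa), List.getElem?_replicate, if_pos h]

theorem getElem?_braidStrands_right {n i : ℕ} (h : n ≤ i) (h' : i < 2 * n) :
    (braidStrands n)[i]? = some false := by
  rw [braidStrands, List.getElem?_append_right (by simpa), List.getElem?_replicate, if_pos]
  simp; omega

theorem run_cross_left {n i : ℕ} (s : Bool) (h : i + 1 < n) :
    run [.cross i s] (braidStrands n) = some (braidStrands n) :=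
  run_cross_of_getElem? s (getElem?_braidStrands_left (by omega)) (getElem?_braidStrands_left h)

theorem run_cross_right {n i : ℕ} (s : Bool) (h : n ≤ i) (h' : i + 1 < 2 * n) :
    run [.cross i s] (braidStrands n) = some (braidStrands n) :=
  run_cross_of_getElem? s (getElem?_braidStrands_right h (by omega))
    (getElem?_braidStrands_right (by omega) h')

theorem run_two {e e' : Event} {st st' st'' : List Bool} (h : run [e] st = some st')
    (h' : run [e'] st' = some st'') : run [e, e'] st = some st'' := by
  rw [← h', ← List.singleton_append, run_append, h, Option.bind_some]

theorem run_max_braidStrands (n : ℕ) :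
    run [.max n true] (braidStrands n) = some (braidStrands (n + 1)) := by
  have h := run_maxima' (n + 1)
  rw [maxima_succ, run_append, run_maxima'] at h
  exact h

theorem run_min_braidStrands (n : ℕ) :
    run [.min n] (braidStrands (n + 1)) = some (braidStrands n) := by
  have := Event.act_append .min 0 (List.replicate n true) (true :: false :: List.replicate n false)
  have e : braidStrands (n + 1) =
      List.replicate n true ++ true :: false :: List.replicate n false := by
    simp [braidStrands, List.replicate_succ' (n := n) (a := true), List.replicate_succ]
  rw [← e] at this
  rw [List.length_replicate, Nat.add_zero] at this
  simp only [run, this]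
  simp [Event.act_zero, Piece.act, braidStrands]

theorem Event.act_one (c : Piece) (a : Bool) (r : List Bool) :
    Event.act ⟨c, 1⟩ (a :: r) = (c.act r).map (a :: ·) := by
  rw [Event.act_succ_cons, Event.act_zero]

theorem Event.act_two (c : Piece) (a b : Bool) (r : List Bool) :
    Event.act ⟨c, 2⟩ (a :: b :: r) = (c.act r).map (a :: b :: ·) := by
  rw [Event.act_succ_cons, Event.act_one, Option.map_map]
  rfl

theorem Event.act_append_zero (c : Piece) (l r : List Bool) :
    Event.act ⟨c, l.length⟩ (l ++ r) = (c.act r).map (l ++ ·) := by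
  simpa [Event.act_zero] using Event.act_append c 0 l r

/-- A crossing slides over two nested maxima. -/
theorem isotopic_max_max_cross (l r : List Bool) (b s : Bool) :
    Isotopic (l ++ r) [.max l.length b, .max (l.length + 1) b, .cross l.length s]
      [.max l.length b, .max (l.length + 1) b, .cross (l.length + 2) s] := by
  -- The crossing slides past one maximum at a time, with an exchange of the maxima in between. Each
  -- slide negates the Boolean, so two slides restore `s`.
  have h1 : Isotopic (l ++ r) [.max l.length b, .max l.length b, .cross (l.length + 1) !s]
      [.max l.length b, .max (l.length + 1) b, .cross l.length s] := by
    refine Isotopic.append_left (st' := l ++ (b :: (!b) :: r)) ?_ [.max l.length b] ?_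
    · have m := Move.slideMax l.length b (!s)
      rw [Bool.not_not] at m
      exact .of_move m (by
        simp [run, Event.act_append_zero, Event.act_append, Event.act_one, Piece.act])
    · simp [run, Event.act_append_zero, Piece.act]
  have h2 : Isotopic (l ++ r) [.max l.length b, .max (l.length + 2) b, .cross (l.length + 1) !s]
      [.max l.length b, .max l.length b, .cross (l.length + 1) !s] := by
    have m : Isotopic (l ++ r) [.max l.length b, .max (l.length + 2) b]
        [.max l.length b, .max l.length b] :=
      .of_move (Move.exchange (.max b) (.max b) l.length l.length le_rfl) (by
        simp [run, Event.act_append_zero, Event.act_append, Event.act_two, Piece.act])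
    exact m.append_right [.cross (l.length + 1) !s]
  have h3 : Isotopic (l ++ r) [.max l.length b, .max (l.length + 1) b, .cross (l.length + 2) s]
      [.max l.length b, .max (l.length + 2) b, .cross (l.length + 1) !s] := by
    refine Isotopic.append_left (st' := l ++ (b :: (!b) :: r)) ?_ [.max l.length b] ?_
    · exact .of_move (Move.slideMax (l.length + 1) b s) (by
        simp [run, Event.act_append, Event.act_one, Event.act_two, Piece.act])
    · simp [run, Event.act_append_zero, Piece.act]
  exact (h3.trans (h2.trans h1)).symm

/-- A crossing slides under two nested minima. -/
theorem isotopic_cross_min_min (l r : List Bool) (a s : Bool) :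
    Isotopic (l ++ (a :: a :: (!a) :: (!a) :: r))
      [.cross (l.length + 2) s, .min (l.length + 1), .min l.length]
      [.cross l.length s, .min (l.length + 1), .min l.length] := by
  have h1 : Isotopic (l ++ (a :: a :: (!a) :: (!a) :: r))
      [.cross (l.length + 2) s, .min (l.length + 1), .min l.length]
      [.cross (l.length + 1) !s, .min (l.length + 2), .min l.length] := by
    have m : Isotopic (l ++ (a :: a :: (!a) :: (!a) :: r))
        [.cross (l.length + 2) s, .min (l.length + 1)]
        [.cross (l.length + 1) !s, .min (l.length + 2)] :=
      .of_move (Move.slideMin (l.length + 1) s) (by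
        simp [run, Event.act_append, Event.act_one, Event.act_two, Piece.act])
    exact m.append_right [.min l.length]
  have h2 : Isotopic (l ++ (a :: a :: (!a) :: (!a) :: r))
      [.cross (l.length + 1) !s, .min l.length, .min l.length]
      [.cross (l.length + 1) !s, .min (l.length + 2), .min l.length] := by
    refine Isotopic.append_left (st' := l ++ (a :: (!a) :: a :: (!a) :: r)) ?_
      [.cross (l.length + 1) !s] ?_
    · exact .of_move (Move.exchange .min .min l.length l.length le_rfl) (by
        simp [run, Event.act_append_zero, Event.act_append, Event.act_two, Piece.act])
    · simp [run, Event.act_append, Event.act_one, Piece.act]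
  have h3 : Isotopic (l ++ (a :: a :: (!a) :: (!a) :: r))
      [.cross (l.length + 1) !s, .min l.length, .min l.length]
      [.cross l.length s, .min (l.length + 1), .min l.length] := by
    have m := Move.slideMin l.length (!s)
    rw [Bool.not_not] at m
    have m' : Isotopic (l ++ (a :: a :: (!a) :: (!a) :: r))
        [.cross (l.length + 1) !s, .min l.length] [.cross l.length s, .min (l.length + 1)] :=
      .of_move m (by
        simp [run, Event.act_append_zero, Event.act_append, Event.act_one, Piece.act])
    exact m'.append_right [.min l.length]
  exact h1.trans (h2.symm.trans h3)

theorem braidStrands_add_two (n : ℕ) : braidStrands (n + 2) =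
    List.replicate n true ++ (true :: true :: (!true) :: (!true) :: List.replicate n false) := by
  rw [braidStrands, List.replicate_add n 2 true, Nat.add_comm n 2, List.replicate_add 2 n false]
  simp [List.replicate]

/-- Strand k closes up with strand 2n - 1 - k, so the crossing reappears, mirrored, at 2n - 2 - i.
In the base case its two strands end in the innermost maxima; every further maximum inside is passed
by exchanges on both sides. -/
theorem isotopic_maxima_cross (n i : ℕ) (s : Bool) (h : i + 2 ≤ n) :
    Isotopic [] (maxima n ++ [.cross i s]) (maxima n ++ [.cross (2 * n - 2 - i) s]) := by
  induction n, h using Nat.le_induction with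
  | base =>
    have := (isotopic_max_max_cross (List.replicate i true) (List.replicate i false)
      true s).append_left (maxima i) (run_maxima' i)
    have e : 2 * (i + 2) - 2 - i = i + 2 := by omega
    rw [List.length_replicate] at this
    simpa [maxima_succ, e] using this
  | succ n hn ih =>
    obtain ⟨j, hj⟩ : ∃ j, 2 * n - 2 - i = j := ⟨_, rfl⟩
    have e : 2 * (n + 1) - 2 - i = j + 2 := by omega
    have h1 : Isotopic (braidStrands n) [.cross i s, .max n true] [.max n true, .cross i s] := by
      obtain ⟨k, rfl⟩ := Nat.exists_eq_add_of_le' (show 2 ≤ n by omega)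
      have h1 := run_cross_left (n := k + 2) s (show i + 1 < k + 2 by omega)
      have h2 := run_cross_left (n := k + 3) s (show i + 1 < k + 3 by omega)
      refine .of_move (Move.exchange (.cross s) (.max true) i k (by omega)) ?_
      exact (run_two h1 (run_max_braidStrands _)).trans
        (run_two (run_max_braidStrands _) h2).symm
    have h2 : Isotopic (braidStrands n) [.max n true, .cross (j + 2) s]
        [.cross j s, .max n true] := by
      have h1 := run_cross_right (n := n) s (show n ≤ j by omega) (by omega)
      have h2 := run_cross_right (n := n + 1) s (show n + 1 ≤ j + 2 by omega) (by omega)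
      refine .of_move (Move.exchange (.max true) (.cross s) n j (by omega)) ?_
      exact (run_two (run_max_braidStrands _) h2).trans
        (run_two h1 (run_max_braidStrands _)).symm
    have h1' := h1.append_left (maxima n) (run_maxima' n)
    have h2' := h2.append_left (maxima n) (run_maxima' n)
    have h3 := ih.append_right [.max n true]
    rw [hj] at h3
    rw [maxima_succ, e]
    simp only [List.append_assoc, List.cons_append, List.nil_append] at h1' h2' h3 ⊢
    exact h1'.symm.trans (h3.trans h2'.symm)

theorem isotopic_cross_minima (n i : ℕ) (s : Bool) (h : i + 2 ≤ n) :
    Isotopic (braidStrands n) (.cross (2 * n - 2 - i) s :: minima n) (.cross i s :: minima n) := by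
  induction n, h using Nat.le_induction with
  | base =>
    have := (isotopic_cross_min_min (List.replicate i true) (List.replicate i false)
      true s).append_right (minima i)
    have e : 2 * (i + 2) - 2 - i = i + 2 := by omega
    rw [List.length_replicate] at this
    simpa [minima_succ, e, braidStrands_add_two] using this
  | succ n hn ih =>
    obtain ⟨j, hj⟩ : ∃ j, 2 * n - 2 - i = j := ⟨_, rfl⟩
    have e : 2 * (n + 1) - 2 - i = j + 2 := by omega
    have h1 : Isotopic (braidStrands (n + 1)) [.cross i s, .min n] [.min n, .cross i s] := by
      obtain ⟨k, rfl⟩ := Nat.exists_eq_add_of_le' (show 2 ≤ n by omega)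
      have h1 := run_cross_left (n := k + 2) s (show i + 1 < k + 2 by omega)
      have h2 := run_cross_left (n := k + 3) s (show i + 1 < k + 3 by omega)
      refine .of_move (Move.exchange (.cross s) .min i k (by omega)) ?_
      exact (run_two h2 (run_min_braidStrands _)).trans
        (run_two (run_min_braidStrands _) h1).symm
    have h2 : Isotopic (braidStrands (n + 1)) [.min n, .cross j s]
        [.cross (j + 2) s, .min n] := by
      have h1 := run_cross_right (n := n) s (show n ≤ j by omega) (by omega)
      have h2 := run_cross_right (n := n + 1) s (show n + 1 ≤ j + 2 by omega) (by omega)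
      refine .of_move (Move.exchange .min (.cross s) n j (by omega)) ?_
      exact (run_two (run_min_braidStrands _) h1).trans
        (run_two h2 (run_min_braidStrands _)).symm
    have h1' := h1.append_right (minima n)
    have h2' := h2.append_right (minima n)
    have h3 := ih.append_left [.min n] (run_min_braidStrands n)
    rw [hj] at h3
    rw [minima_succ, e]
    exact h2'.symm.trans (h3.trans h1'.symm)

/-! ### Markov moves and the trace on braid words -/

/-- A letter `(i, s)` of a braid word with any number of strands. -/
abbrev Letter : Type := ℕ × Bool

/-- The words in the generators of the braid group on `n` strands. -/
def IsWord (n : ℕ) (W : List Letter) : Prop := ∀ a ∈ W, a.1 + 1 < n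

theorem isWord_append {n : ℕ} {u v : List Letter} :
    IsWord n (u ++ v) ↔ IsWord n u ∧ IsWord n v := List.forall_mem_append

theorem isWord_cons {n : ℕ} {a : Letter} {u : List Letter} :
    IsWord n (a :: u) ↔ a.1 + 1 < n ∧ IsWord n u := List.forall_mem_cons

theorem isWord_nil (n : ℕ) : IsWord n [] := by simp [IsWord]

theorem IsWord.mono {n m : ℕ} {W : List Letter} (h : IsWord n W) (hnm : n ≤ m) : IsWord m W :=
  fun a ha => (h a ha).trans_le hnm

def crossings (W : List Letter) : List Event := W.map fun a => Event.cross a.1 a.2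

theorem crossings_append (u v : List Letter) :
    crossings (u ++ v) = crossings u ++ crossings v := List.map_append

theorem run_crossings' {n : ℕ} {W : List Letter} (h : IsWord n W) :
    run (crossings W) (braidStrands n) = some (braidStrands n) := by
  induction W with
  | nil => rfl
  | cons a W ih =>
    obtain ⟨h1, h2⟩ := isWord_cons.1 h
    have := run_append [.cross a.1 a.2] (crossings W) (braidStrands n)
    rw [run_cross_left _ h1, Option.bind_some, ih h2] at this
    exact this

def closedBraid (n : ℕ) (hn : 1 ≤ n) (W : List Letter) (hW : IsWord n W) : Diagram where
  events := maxima n ++ (crossings W ++ minima n)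
  ne_nil := by
    obtain ⟨n, rfl⟩ := Nat.exists_eq_add_of_le' hn
    simp [maxima_succ]
  closed := by
    rw [run_append, run_maxima', Option.bind_some, run_append, run_crossings' hW,
      Option.bind_some, run_minima']

open Classical in
/-- The value on the closure of a braid word of a function on links. -/
noncomputable def closureValue (f : Link → ℤ[X]) (n : ℕ) (W : List Letter) : ℤ[X] :=
  if h : 1 ≤ n ∧ IsWord n W then f (closedBraid n h.1 W h.2).link else 0

/-- The properties of the Conway polynomial of closed braids. -/
structure IsConwayTrace (g : ℕ → List Letter → ℤ[X]) : Prop where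
  one : g 1 [] = 1
  cancel : ∀ {n i : ℕ} (s : Bool) (u v : List Letter), i + 1 < n →
    g n (u ++ (i, s) :: (i, !s) :: v) = g n (u ++ v)
  braid : ∀ {n i : ℕ} (s : Bool) (u v : List Letter), i + 2 < n →
    g n (u ++ (i, s) :: (i + 1, s) :: (i, s) :: v) =
      g n (u ++ (i + 1, s) :: (i, s) :: (i + 1, s) :: v)
  comm : ∀ {n i j : ℕ} (s t : Bool) (u v : List Letter), i + 2 ≤ j → j + 1 < n →
    g n (u ++ (i, s) :: (j, t) :: v) = g n (u ++ (j, t) :: (i, s) :: v)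
  rotate : ∀ (n : ℕ) (a : Letter) (u : List Letter), g n (a :: u) = g n (u ++ [a])
  stabilize : ∀ {n : ℕ} (s : Bool) {u : List Letter}, IsWord (n + 1) u →
    g (n + 2) (u ++ [(n, s)]) = g (n + 1) u
  skein : ∀ {n i : ℕ} (u v : List Letter), i + 1 < n →
    g n (u ++ (i, true) :: v) - g n (u ++ (i, false) :: v) = X * g n (u ++ v)

theorem closureValue_eq (f : Link → ℤ[X]) {n n' : ℕ} {W W' : List Letter} (hn : 1 ≤ n)
    (hn' : 1 ≤ n') (hW : IsWord n W) (hW' : IsWord n' W')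
    (h : Isotopic [] (maxima n ++ (crossings W ++ minima n))
      (maxima n' ++ (crossings W' ++ minima n'))) :
    closureValue f n W = closureValue f n' W' := by
  rw [closureValue, closureValue, dif_pos ⟨hn, hW⟩, dif_pos ⟨hn', hW'⟩]
  exact congrArg f (h.2 [] [] _ _ rfl (by simp [closedBraid]) (by simp [closedBraid]))

theorem closureValue_eq_zero (f : Link → ℤ[X]) {n : ℕ} {W : List Letter} (hW : ¬ IsWord n W) :
    closureValue f n W = 0 := dif_neg fun h => hW h.2

/-- No condition on `u` and `v` is needed: if either has a letter out of range, both values are the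
default 0. -/
theorem closureValue_eq_of_isotopic (f : Link → ℤ[X]) {n : ℕ} {L L' : List Letter}
    (u v : List Letter) (hn : 1 ≤ n) (hL : IsWord n L) (hL' : IsWord n L')
    (h : Isotopic (braidStrands n) (crossings L) (crossings L')) :
    closureValue f n (u ++ (L ++ v)) = closureValue f n (u ++ (L' ++ v)) := by
  by_cases hu : IsWord n u
  swap
  · rw [closureValue_eq_zero f fun h => hu (isWord_append.1 h).1,
      closureValue_eq_zero f fun h => hu (isWord_append.1 h).1]
  by_cases hv : IsWord n v
  swap
  · rw [closureValue_eq_zero f fun h => hv (isWord_append.1 (isWord_append.1 h).2).2,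
      closureValue_eq_zero f fun h => hv (isWord_append.1 (isWord_append.1 h).2).2]
  have := h.context (st := []) (maxima n ++ crossings u) (crossings v ++ minima n) (by
    rw [run_append, run_maxima', Option.bind_some, run_crossings' hu])
  refine closureValue_eq f hn hn (by simp [isWord_append, *]) (by simp [isWord_append, *]) ?_
  simpa [crossings_append] using this

theorem run_crossings_eq {n : ℕ} {L L' : List Letter} (hL : IsWord n L) (hL' : IsWord n L') :
    run (crossings L) (braidStrands n) = run (crossings L') (braidStrands n) := by
  rw [run_crossings' hL, run_crossings' hL']

theorem isotopic_max_crossings {n : ℕ} {u : List Letter} (hu : IsWord n u) :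
    Isotopic (braidStrands n) (.max n true :: crossings u) (crossings u ++ [.max n true]) := by
  induction u with
  | nil => exact .refl _ _
  | cons a u ih =>
    obtain ⟨h1, h2⟩ := isWord_cons.1 hu
    obtain ⟨k, rfl⟩ := Nat.exists_eq_add_of_le' (show 2 ≤ n by omega)
    have m : Isotopic (braidStrands (k + 2)) [.max (k + 2) true, .cross a.1 a.2]
        [.cross a.1 a.2, .max (k + 2) true] := by
      refine (Isotopic.of_move (Move.exchange (.cross a.2) (.max true) a.1 k (by omega)) ?_).symm
      exact (run_two (run_cross_left _ h1) (run_max_braidStrands _)).trans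
        (run_two (run_max_braidStrands _) (run_cross_left _ (h1.trans (by simp)))).symm
    exact (m.append_right (crossings u)).trans
      ((ih h2).append_left [.cross a.1 a.2] (run_cross_left _ h1))

theorem isotopic_cross_crossings {n j : ℕ} (s : Bool) {u : List Letter} (hu : IsWord n u)
    (h : n ≤ j) (h' : j + 1 < 2 * n) :
    Isotopic (braidStrands n) (.cross j s :: crossings u) (crossings u ++ [.cross j s]) := by
  induction u with
  | nil => exact .refl _ _
  | cons a u ih =>
    obtain ⟨h1, h2⟩ := isWord_cons.1 hu
    obtain ⟨k, rfl⟩ := Nat.exists_eq_add_of_le' (show 2 ≤ j by omega)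
    have m : Isotopic (braidStrands n) [.cross (k + 2) s, .cross a.1 a.2]
        [.cross a.1 a.2, .cross (k + 2) s] := by
      refine (Isotopic.of_move (Move.exchange (.cross a.2) (.cross s) a.1 k (by omega)) ?_).symm
      exact (run_two (run_cross_left _ h1) (run_cross_right _ h h')).trans
        (run_two (run_cross_right _ h h') (run_cross_left _ h1)).symm
    exact (m.append_right (crossings u)).trans
      ((ih h2).append_left [.cross a.1 a.2] (run_cross_left _ h1))

/-- The first crossing travels once around the closure: over the maxima, down along the closing
strands beside the braid, and back under the minima. -/
theorem isotopic_rotate {n : ℕ} {a : Letter} {u : List Letter} (ha : a.1 + 1 < n)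
    (hu : IsWord n u) :
    Isotopic [] (maxima n ++ (crossings (a :: u) ++ minima n))
      (maxima n ++ (crossings (u ++ [a]) ++ minima n)) := by
  obtain ⟨j, hj⟩ : ∃ j, 2 * n - 2 - a.1 = j := ⟨_, rfl⟩
  have h1 := (isotopic_maxima_cross n a.1 a.2 ha).append_right (crossings u ++ minima n)
  have h2 := ((isotopic_cross_crossings a.2 hu (show n ≤ j by omega) (by omega)).append_right
    (minima n)).append_left (maxima n) (run_maxima' n)
  have h3 := ((isotopic_cross_minima n a.1 a.2 ha).append_left (crossings u)
    (run_crossings' hu)).append_left (maxima n) (run_maxima' n)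
  rw [hj] at h1 h3
  simp only [crossings, List.map_cons, List.map_append, List.map_nil, List.append_assoc,
    List.cons_append, List.nil_append] at h1 h2 h3 ⊢
  exact h1.trans (h2.trans h3)

/-- The innermost maximum descends past `u` and forms, with the last crossing and the innermost
minimum, a curl removed by Reidemeister 1. -/
theorem isotopic_stabilize {n : ℕ} (s : Bool) {u : List Letter} (hu : IsWord (n + 1) u) :
    Isotopic [] (maxima (n + 2) ++ (crossings (u ++ [(n, s)]) ++ minima (n + 2)))
      (maxima (n + 1) ++ (crossings u ++ minima (n + 1))) := by
  have h1 := ((isotopic_max_crossings hu).append_right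
    (.cross n s :: minima (n + 2))).append_left (maxima (n + 1)) (run_maxima' (n + 1))
  have m : Isotopic (braidStrands (n + 1)) [.max (n + 1) true, .cross n s, .min (n + 1)] [] := by
    refine .of_move (Move.reidemeister1Right n true s) ?_
    have e := run_append [.max (n + 1) true] [.cross n s, .min (n + 1)] (braidStrands (n + 1))
    rw [run_max_braidStrands, Option.bind_some,
      run_two (run_cross_left s (by omega)) (run_min_braidStrands (n + 1))] at e
    exact e
  have h2 := ((m.append_right (minima (n + 1))).append_left (crossings u)
    (run_crossings' hu)).append_left (maxima (n + 1)) (run_maxima' (n + 1))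
  rw [maxima_succ (n + 1)]
  simp only [minima_succ (n + 1), crossings, List.map_cons, List.map_append, List.map_nil,
    List.append_assoc, List.cons_append, List.nil_append] at h1 h2 ⊢
  exact h1.trans h2

theorem isConwayTrace_closureValue {f : Link → ℤ[X]} (hf : IsConwayPolynomial f) :
    IsConwayTrace (closureValue f) where
  one := by
    rw [closureValue, dif_pos ⟨le_rfl, isWord_nil 1⟩, ← hf.unknot]
    rfl
  cancel {n i} s u v hi := by
    have h1 : IsWord n [(i, s), (i, !s)] := by simp [IsWord, hi]
    exact closureValue_eq_of_isotopic f u v (by omega) h1 (isWord_nil n)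
      (.of_move (Move.reidemeister2 i s) (run_crossings_eq h1 (isWord_nil n)))
  braid {n i} s u v hi := by
    have h1 : IsWord n [(i, s), (i + 1, s), (i, s)] := by simp [IsWord]; omega
    have h2 : IsWord n [(i + 1, s), (i, s), (i + 1, s)] := by simp [IsWord]; omega
    exact closureValue_eq_of_isotopic f u v (by omega) h1 h2
      (.of_move (Move.reidemeister3 i s) (run_crossings_eq h1 h2))
  comm {n i j} s t u v hij hj := by
    obtain ⟨k, rfl⟩ := Nat.exists_eq_add_of_le' (show 2 ≤ j by omega)
    have h1 : IsWord n [(i, s), (k + 2, t)] := by simp [IsWord]; omega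
    have h2 : IsWord n [(k + 2, t), (i, s)] := by simp [IsWord]; omega
    exact closureValue_eq_of_isotopic f u v (by omega) h1 h2
      (.of_move (Move.exchange (.cross s) (.cross t) i k (by omega)) (run_crossings_eq h1 h2))
  rotate n a u := by
    by_cases h : a.1 + 1 < n ∧ IsWord n u
    · exact closureValue_eq f (by omega) (by omega) (isWord_cons.2 h)
        (isWord_append.2 ⟨h.2, by simpa [IsWord] using h.1⟩) (isotopic_rotate h.1 h.2)
    · rw [closureValue_eq_zero f fun h' => h (isWord_cons.1 h'),
        closureValue_eq_zero f fun h' => h ?_]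
      rw [isWord_append, isWord_cons] at h'
      exact ⟨h'.2.1, h'.1⟩
  stabilize {n} s u hu :=
    closureValue_eq f (by omega) (by omega)
      (isWord_append.2 ⟨hu.mono (by omega), by simp [IsWord]⟩) hu (isotopic_stabilize s hu)
  skein {n i} u v hi := by
    by_cases h : IsWord n u ∧ IsWord n v
    · have hw : ∀ s, IsWord n (u ++ (i, s) :: v) := fun s =>
        isWord_append.2 ⟨h.1, isWord_cons.2 ⟨hi, h.2⟩⟩
      have hn : 1 ≤ n := by omega
      rw [closureValue, closureValue, closureValue, dif_pos ⟨hn, hw _⟩, dif_pos ⟨hn, hw _⟩,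
        dif_pos ⟨hn, isWord_append.2 h⟩]
      refine hf.skein _ _ _ ⟨maxima n ++ crossings u, crossings v ++ minima n, i, braidStrands n,
        true, ?_, getElem?_braidStrands_left (by omega), getElem?_braidStrands_left hi, ?_, ?_, ?_⟩
      · rw [run_append, run_maxima', Option.bind_some, run_crossings' h.1]
      all_goals simp [closedBraid, crossings]
    · have hw : ∀ s, ¬ IsWord n (u ++ (i, s) :: v) := fun s h' =>
        h ⟨(isWord_append.1 h').1, (isWord_cons.1 (isWord_append.1 h').2).2⟩
      rw [closureValue_eq_zero f (hw _), closureValue_eq_zero f (hw _),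
        closureValue_eq_zero f fun h' => h (isWord_append.1 h')]
      simp

/-! ## Degrees -/

/-- The degree of a polynomial is at most the integer `d` (so that it is zero for `d < 0`). -/
def DegLE (P : ℤ[X]) (d : ℤ) : Prop := ∀ k : ℕ, d < k → P.coeff k = 0

namespace DegLE

variable {P Q : ℤ[X]} {d e : ℤ}

theorem mono (h : DegLE P d) (hde : d ≤ e) : DegLE P e := fun k hk => h k (hde.trans_lt hk)

theorem zero (d : ℤ) : DegLE 0 d := fun _ _ => coeff_zero _

theorem add (h : DegLE P d) (h' : DegLE Q d) : DegLE (P + Q) d := fun k hk => by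
  rw [coeff_add, h k hk, h' k hk, add_zero]

theorem sub (h : DegLE P d) (h' : DegLE Q d) : DegLE (P - Q) d := fun k hk => by
  rw [coeff_sub, h k hk, h' k hk, sub_zero]

theorem neg (h : DegLE P d) : DegLE (-P) d := fun k hk => by
  rw [coeff_neg, h k hk, neg_zero]

theorem X_mul (h : DegLE P d) (hde : d + 1 ≤ e) : DegLE (X * P) e := by
  intro k hk
  rcases k with _ | k
  · simp
  · rw [coeff_X_mul]
    exact h k (by push_cast at hk; omega)

end DegLE

/-- The polynomial `±z`. -/
noncomputable def signX (s : Bool) : ℤ[X] := if s then X else -X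

theorem DegLE.signX_mul {P : ℤ[X]} {d e : ℤ} (s : Bool) (h : DegLE P d) (hde : d + 1 ≤ e) :
    DegLE (signX s * P) e := by
  cases s
  · simpa [signX] using (h.X_mul hde).neg
  · simpa [signX] using h.X_mul hde

/-! ## Functionals on the Hecke algebra -/

/-- Functions of braid words on `n` strands that respect the braid relations and the skein
relation. -/
structure IsBraidFunctional (n : ℕ) (φ : List Letter → ℤ[X]) : Prop where
  cancel : ∀ {i : ℕ} (s : Bool) (u v : List Letter), i + 1 < n →
    φ (u ++ (i, s) :: (i, !s) :: v) = φ (u ++ v)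
  braid : ∀ {i : ℕ} (s : Bool) (u v : List Letter), i + 2 < n →
    φ (u ++ (i, s) :: (i + 1, s) :: (i, s) :: v) =
      φ (u ++ (i + 1, s) :: (i, s) :: (i + 1, s) :: v)
  comm : ∀ {i j : ℕ} (s t : Bool) (u v : List Letter), i + 2 ≤ j → j + 1 < n →
    φ (u ++ (i, s) :: (j, t) :: v) = φ (u ++ (j, t) :: (i, s) :: v)
  skein : ∀ {i : ℕ} (u v : List Letter), i + 1 < n →
    φ (u ++ (i, true) :: v) - φ (u ++ (i, false) :: v) = X * φ (u ++ v)

theorem IsConwayTrace.functional {g : ℕ → List Letter → ℤ[X]} (h : IsConwayTrace g) (n : ℕ) :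
    IsBraidFunctional n (g n) where
  cancel s u v := h.cancel s u v
  braid s u v := h.braid s u v
  comm s t u v := h.comm s t u v
  skein u v := h.skein u v

namespace IsBraidFunctional

variable {n : ℕ} {φ χ : List Letter → ℤ[X]}

theorem mono {m : ℕ} (h : IsBraidFunctional n φ) (hm : m ≤ n) : IsBraidFunctional m φ where
  cancel s u v hi := h.cancel s u v (hi.trans_le hm)
  braid s u v hi := h.braid s u v (hi.trans_le hm)
  comm s t u v hij hj := h.comm s t u v hij (hj.trans_le hm)
  skein u v hi := h.skein u v (hi.trans_le hm)

theorem context (h : IsBraidFunctional n φ) (a b : List Letter) :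
    IsBraidFunctional n fun y => φ (a ++ (y ++ b)) where
  cancel s u v hi := by simpa using h.cancel s (a ++ u) (v ++ b) hi
  braid s u v hi := by simpa using h.braid s (a ++ u) (v ++ b) hi
  comm s t u v hij hj := by simpa using h.comm s t (a ++ u) (v ++ b) hij hj
  skein u v hi := by simpa using h.skein (a ++ u) (v ++ b) hi

theorem sub (h : IsBraidFunctional n φ) (h' : IsBraidFunctional n χ) :
    IsBraidFunctional n fun y => φ y - χ y where
  cancel s u v hi := by rw [h.cancel s u v hi, h'.cancel s u v hi]
  braid s u v hi := by rw [h.braid s u v hi, h'.braid s u v hi]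
  comm s t u v hij hj := by rw [h.comm s t u v hij hj, h'.comm s t u v hij hj]
  skein u v hi := by
    rw [mul_sub, ← h.skein u v hi, ← h'.skein u v hi]
    ring

theorem flip (h : IsBraidFunctional n φ) {i : ℕ} (s : Bool) (u v : List Letter) (hi : i + 1 < n) :
    φ (u ++ (i, s) :: v) = φ (u ++ (i, !s) :: v) + signX s * φ (u ++ v) := by
  have := h.skein u v hi
  cases s
  · simp only [signX, Bool.not_false, Bool.false_eq_true, if_false]
    linear_combination -this
  · simp only [signX, Bool.not_true, if_true]
    linear_combination this

theorem square (h : IsBraidFunctional n φ) {i : ℕ} (s : Bool) (u v : List Letter)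
    (hi : i + 1 < n) :
    φ (u ++ (i, s) :: (i, s) :: v) = φ (u ++ v) + signX s * φ (u ++ (i, s) :: v) := by
  rw [h.flip s u ((i, s) :: v) hi]
  have := h.cancel (!s) u v hi
  rw [Bool.not_not] at this
  rw [this]

/-- A letter commutes with words in letters that are at least two below. -/
theorem comm_word (h : IsBraidFunctional n φ) {N : ℕ} (hN : N + 1 < n) (s : Bool)
    (u y v : List Letter) (hy : IsWord N y) :
    φ (u ++ (N, s) :: (y ++ v)) = φ (u ++ (y ++ (N, s) :: v)) := by
  induction y generalizing u with
  | nil => rfl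
  | cons a y ih =>
    obtain ⟨h1, h2⟩ := isWord_cons.1 hy
    have := h.comm a.2 s u (y ++ v) (show a.1 + 2 ≤ N from h1) hN
    have := ih (u ++ [a]) h2
    simp_all

/-- An identity of the braid group. The available braid relation has three equal signs, so a
cancelling pair of letters of index i is first inserted, on the left if c = s and on the right
otherwise. -/
theorem conj (h : IsBraidFunctional n φ) {i : ℕ} (hi : i + 2 < n) (s c : Bool)
    (u v : List Letter) :
    φ (u ++ (i + 1, s) :: (i, c) :: (i + 1, !s) :: v) =
      φ (u ++ (i, !s) :: (i + 1, c) :: (i, s) :: v) := by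
  have hi' : i + 1 < n := by omega
  by_cases hc : c = s
  · subst hc
    have h1 := h.cancel (!c) u ((i + 1, c) :: (i, c) :: (i + 1, !c) :: v) hi'
    have h2 := h.braid c (u ++ [(i, !c)]) ((i + 1, !c) :: v) hi
    have h3 := h.cancel c (u ++ [(i, !c), (i + 1, c), (i, c)]) v hi
    simp only [Bool.not_not, List.append_assoc, List.cons_append, List.nil_append] at h1 h2 h3
    rw [← h1, h2, h3]
  · obtain rfl : c = !s := by cases c <;> cases s <;> simp_all
    have h1 := h.cancel (!s) (u ++ [(i + 1, s), (i, !s), (i + 1, !s)]) v hi'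
    have h2 := h.braid (!s) (u ++ [(i + 1, s)]) ((i, s) :: v) hi
    have h3 := h.cancel s u ((i, !s) :: (i + 1, !s) :: (i, s) :: v) hi
    simp only [Bool.not_not, List.append_assoc, List.cons_append, List.nil_append] at h1 h2 h3
    rw [← h1, h2, h3]

end IsBraidFunctional

theorem exists_eq_append_of_not_isWord {N : ℕ} {W : List Letter} (hW : IsWord (N + 2) W)
    (h : ¬ IsWord (N + 1) W) :
    ∃ u s v, W = u ++ (N, s) :: v ∧ IsWord (N + 1) u ∧ IsWord (N + 2) v := by
  induction W with
  | nil => exact absurd (isWord_nil _) h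
  | cons a W ih =>
    obtain ⟨h1, h2⟩ := isWord_cons.1 hW
    by_cases ha : a.1 = N
    · exact ⟨[], a.2, W, by simp [← ha], isWord_nil _, h2⟩
    · obtain ⟨u, s, v, e, hu, hv⟩ := ih h2 fun h' => h (isWord_cons.2 ⟨by omega, h'⟩)
      exact ⟨a :: u, s, v, by simp [e], isWord_cons.2 ⟨by omega, hu⟩, hv⟩

/-- The number of letters of a word with a given index. -/
def topCount (N : ℕ) (W : List Letter) : ℕ := W.countP fun a => a.1 == N

theorem topCount_append (N : ℕ) (u v : List Letter) :
    topCount N (u ++ v) = topCount N u + topCount N v := List.countP_append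

theorem topCount_cons (N : ℕ) (a : Letter) (u : List Letter) :
    topCount N (a :: u) = topCount N u + if a.1 = N then 1 else 0 := by
  simp [topCount, List.countP_cons]

theorem topCount_eq_zero {N : ℕ} {W : List Letter} (h : IsWord (N + 1) W) : topCount N W = 0 := by
  rw [topCount, List.countP_eq_zero]
  intro a ha
  have := h a ha
  simp; omega

/-! ### Lowering the number of occurrences of the last generator -/

section Reduction

variable {N : ℕ} {φ : List Letter → ℤ[X]} {C : ℤ} {K : ℕ}

/-- Adjacent letters either cancel or satisfy σ² = 1 ± zσ. In both cases fewer top letters remain,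
and the factor z is paid for by the lost letter. -/
theorem DegLE.pair (hφ : IsBraidFunctional (N + 2) φ)
    (ih : ∀ W, IsWord (N + 2) W → topCount N W < K → DegLE (φ W) (W.length + C))
    {a b : List Letter} (ha : IsWord (N + 2) a) (hb : IsWord (N + 2) b)
    (hK : topCount N a + topCount N b + 2 ≤ K) (s t : Bool) :
    DegLE (φ (a ++ (N, s) :: (N, t) :: b)) (a.length + b.length + 2 + C) := by
  have h1 : DegLE (φ (a ++ b)) (a.length + b.length + C) := by
    have := ih (a ++ b) (isWord_append.2 ⟨ha, hb⟩) (by rw [topCount_append]; omega)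
    exact this.mono (by simp)
  by_cases hst : t = s
  · subst hst
    rw [hφ.square t a b (by omega)]
    refine (h1.mono (by omega)).add ?_
    have := ih (a ++ (N, t) :: b)
      (isWord_append.2 ⟨ha, isWord_cons.2 ⟨by simp, hb⟩⟩)
      (by rw [topCount_append, topCount_cons]; simp; omega)
    exact this.signX_mul t (by simp; omega)
  · obtain rfl : t = !s := by cases t <;> cases s <;> simp_all
    rw [hφ.cancel s a b (by omega)]
    exact h1.mono (by omega)

/-- Braid relations turn the two top letters into one. The exceptional sign pattern, equal outer
signs around the opposite one, first has its middle letter flipped, at the cost of z times an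
adjacent pair. -/
theorem DegLE.triple {M : ℕ} (hφ : IsBraidFunctional (M + 3) φ)
    (ih : ∀ W, IsWord (M + 3) W → topCount (M + 1) W < K → DegLE (φ W) (W.length + C))
    {a b : List Letter} (ha : IsWord (M + 3) a) (hb : IsWord (M + 3) b)
    (hK : topCount (M + 1) a + topCount (M + 1) b + 2 ≤ K) (s c t : Bool) :
    DegLE (φ (a ++ (M + 1, s) :: (M, c) :: (M + 1, t) :: b))
      (a.length + b.length + 3 + C) := by
  have low : ∀ x y z : Bool, DegLE (φ (a ++ (M, x) :: (M + 1, y) :: (M, z) :: b))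
      (a.length + b.length + 3 + C) := by
    intro x y z
    have := ih (a ++ (M, x) :: (M + 1, y) :: (M, z) :: b)
      (isWord_append.2 ⟨ha, by simp [isWord_cons, hb]⟩)
      (by simp [topCount_append, topCount_cons]; omega)
    exact this.mono (by simp; omega)
  by_cases hst : t = s
  · subst hst
    have same : DegLE (φ (a ++ (M + 1, t) :: (M, t) :: (M + 1, t) :: b))
        (a.length + b.length + 3 + C) := by
      rw [← hφ.braid t a b (by omega)]
      exact low t t t
    by_cases hc : c = t
    · subst hc
      exact same
    · obtain rfl : c = !t := by cases c <;> cases t <;> simp_all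
      have := hφ.flip (!t) (a ++ [(M + 1, t)]) ((M + 1, t) :: b) (show M + 1 < M + 3 by omega)
      simp only [Bool.not_not, List.append_assoc, List.cons_append, List.nil_append] at this
      rw [this]
      refine same.add ((DegLE.pair hφ ih ha hb hK t t).signX_mul _ (by omega))
  · obtain rfl : t = !s := by cases t <;> cases s <;> simp_all
    rw [hφ.conj (by omega)]
    exact low _ _ _

theorem DegLE.of_pairs
    (h0 : ∀ u, IsWord (N + 1) u → DegLE (φ u) (u.length + C))
    (h1 : ∀ u s v, IsWord (N + 1) u → IsWord (N + 1) v →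
      DegLE (φ (u ++ (N, s) :: v)) (u.length + v.length + 1 + C))
    (h2 : ∀ (K : ℕ) (a b : List Letter) (s t : Bool),
      (∀ W, IsWord (N + 2) W → topCount N W < K → DegLE (φ W) (W.length + C)) →
      IsWord (N + 2) a → IsWord (N + 2) b → topCount N a + topCount N b + 2 ≤ K →
      ∀ y, IsWord (N + 1) y →
        DegLE (φ (a ++ ((N, s) :: y ++ (N, t) :: b))) (a.length + b.length + 2 + y.length + C)) :
    ∀ W, IsWord (N + 2) W → DegLE (φ W) (W.length + C) := by
  intro W hW
  induction hk : topCount N W using Nat.strong_induction_on generalizing W with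
  | _ k ih =>
    by_cases hW0 : IsWord (N + 1) W
    · exact h0 W hW0
    obtain ⟨u, s, v, rfl, hu, hv⟩ := exists_eq_append_of_not_isWord hW hW0
    by_cases hv0 : IsWord (N + 1) v
    · exact (h1 u s v hu hv0).mono (by simp)
    obtain ⟨y, t, v', rfl, hy, hv'⟩ := exists_eq_append_of_not_isWord hv hv0
    have := h2 k u v' s t (fun W' hW' hlt => ih _ hlt W' hW' rfl) (hu.mono (by omega)) hv' (by
      rw [← hk]
      simp [topCount_append, topCount_cons]
      omega) y hy
    refine DegLE.mono this ?_
    simp; omega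

end Reduction

theorem isWord_one {W : List Letter} (h : IsWord 1 W) : W = [] := by
  cases W with
  | nil => rfl
  | cons a W => exact absurd (isWord_cons.1 h).1 (by omega)

/-- A degree bound for the functionals on the Hecke algebra that need only be checked on words in
which the last generator appears at most once. -/
theorem DegLE.of_reduced (N : ℕ) : ∀ {φ : List Letter → ℤ[X]} {C : ℤ},
    IsBraidFunctional (N + 2) φ →
    (∀ u, IsWord (N + 1) u → DegLE (φ u) (u.length + C)) →
    (∀ u s v, IsWord (N + 1) u → IsWord (N + 1) v →
      DegLE (φ (u ++ (N, s) :: v)) (u.length + v.length + 1 + C)) →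
    ∀ W, IsWord (N + 2) W → DegLE (φ W) (W.length + C) := by
  induction N with
  | zero =>
    intro φ C hφ h0 h1
    refine DegLE.of_pairs h0 h1 fun K a b s t ih ha hb hK y hy => ?_
    obtain rfl := isWord_one hy
    exact (DegLE.pair hφ ih ha hb hK s t).mono (by simp)
  | succ M ihM =>
    intro φ C hφ h0 h1
    refine DegLE.of_pairs h0 h1 fun K a b s t ih ha hb hK y hy => ?_
    -- The value is regarded as a functional of the word y between the two top letters, which lives
    -- on one strand fewer. By induction y may be assumed to contain its own last generator at most
    -- once; its other letters commute with the top ones, leaving a `pair` or a `triple`.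
    have key := ihM (φ := fun y => φ (a ++ [(M + 1, s)] ++ (y ++ (M + 1, t) :: b)))
      (C := a.length + b.length + 2 + C) ((hφ.context _ _).mono (by omega)) ?_ ?_ y hy
    · simp only [List.append_assoc, List.cons_append, List.nil_append] at key ⊢
      exact key.mono (by omega)
    · intro u hu
      have e := hφ.comm_word (by omega) s a u ((M + 1, t) :: b) hu
      simp only [List.append_assoc, List.cons_append, List.nil_append]
      rw [e]
      have hu' : IsWord (M + 3) u := hu.mono (by omega)
      have := DegLE.pair hφ ih (a := a ++ u) (isWord_append.2 ⟨ha, hu'⟩) hb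
        (by rwa [topCount_append, topCount_eq_zero (hu.mono (by omega)), add_zero]) s t
      simp only [List.append_assoc] at this
      exact this.mono (by simp; omega)
    · intro u c v hu hv
      have hu' : IsWord (M + 3) u := hu.mono (by omega)
      have hv' : IsWord (M + 3) v := hv.mono (by omega)
      have e1 := hφ.comm_word (by omega) s a u ((M, c) :: (v ++ (M + 1, t) :: b)) hu
      have e2 := hφ.comm_word (by omega) t (a ++ u ++ [(M + 1, s), (M, c)]) v b hv
      simp only [List.append_assoc, List.cons_append, List.nil_append] at e1 e2 ⊢
      rw [e1, ← e2]
      have := DegLE.triple hφ ih (a := a ++ u) (b := v ++ b) (isWord_append.2 ⟨ha, hu'⟩)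
        (isWord_append.2 ⟨hv', hb⟩)
        (by rwa [topCount_append, topCount_append, topCount_eq_zero (hu.mono (by omega)),
          topCount_eq_zero (hv.mono (by omega)), add_zero, zero_add]) s c t
      simp only [List.append_assoc] at this
      exact this.mono (by simp; omega)

/-! ## Degrees for closed braids -/

namespace IsConwayTrace

variable {g : ℕ → List Letter → ℤ[X]}

theorem rotate_append (hg : IsConwayTrace g) (n : ℕ) (u v : List Letter) : g n (u ++ v) = g n (v ++ u) := by
  induction u generalizing v with
  | nil => simp
  | cons a u ih =>
    rw [List.cons_append, hg.rotate, List.append_assoc, ih]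
    simp

theorem destabilize (hg : IsConwayTrace g) {N : ℕ} (s : Bool) {u v : List Letter} (hu : IsWord (N + 1) u)
    (hv : IsWord (N + 1) v) : g (N + 2) (u ++ (N, s) :: v) = g (N + 1) (u ++ v) := by
  rw [hg.rotate_append, List.cons_append, hg.rotate, hg.stabilize s (isWord_append.2 ⟨hv, hu⟩),
    hg.rotate_append]

/-- Adding a last crossing of either sign gives the same link by destabilization, so the skein
relation leaves z times the value equal to 0. -/
theorem split (hg : IsConwayTrace g) {N : ℕ} {u : List Letter} (hu : IsWord (N + 1) u) : g (N + 2) u = 0 := by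
  have h := hg.skein (n := N + 2) (i := N) u [] (by omega)
  rw [hg.stabilize _ hu, hg.stabilize _ hu, sub_self, List.append_nil] at h
  exact (mul_eq_zero.1 h.symm).resolve_left X_ne_zero

/-- By `DegLE.of_reduced` only two cases remain: without the last generator the value is 0, and with
one occurrence it destabilizes, losing one letter and one strand. -/
theorem degLE (hg : IsConwayTrace g) (N : ℕ) {W : List Letter} (hW : IsWord (N + 1) W) :
    DegLE (g (N + 1) W) (W.length - N) := by
  induction N generalizing W with
  | zero =>
    obtain rfl := isWord_one hW
    intro k hk
    rw [hg.one, coeff_one, if_neg]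
    rintro rfl
    simp at hk
  | succ N ih =>
    refine (DegLE.of_reduced N (C := -(N + 1)) (hg.functional _) ?_ ?_ W hW).mono
      (by push_cast; omega)
    · intro u hu
      rw [hg.split hu]
      exact .zero _
    · intro u s v hu hv
      rw [hg.destabilize s hu hv]
      exact (ih (isWord_append.2 ⟨hu, hv⟩)).mono (by simp)

/-- Two occurrences of the last generator with opposite signs lower the degree. -/
theorem degLE_opposite (hg : IsConwayTrace g) (N : ℕ) (s : Bool) {u v : List Letter} (hu : IsWord (N + 1) u)
    (hv : IsWord (N + 1) v) :
    DegLE (g (N + 2) ((N, s) :: (u ++ (N, !s) :: v))) (u.length + v.length - N - 1) := by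
  have hφ := hg.functional (N + 2)
  rcases N with _ | M
  · obtain rfl := isWord_one hu
    have := hg.cancel s [] v (show 0 + 1 < 2 by omega)
    simp only [List.nil_append] at this ⊢
    rw [this, hg.split hv]
    exact .zero _
  -- The bound, two below that of `degLE`, is reduced to words u with at most one letter of index M.
  -- With none, the opposite letters meet and cancel, leaving a split closure. With one, `conj`
  -- leaves a single top letter; its destabilization makes the outer letters cancel.
  have key := DegLE.of_reduced M
    (φ := fun y => g (M + 3) ([(M + 1, s)] ++ (y ++ (M + 1, !s) :: v)))
    (C := v.length - M - 2) ((hφ.context _ _).mono (by omega)) ?_ ?_ u hu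
  · exact key.mono (by push_cast; omega)
  · intro y hy
    have e := hφ.comm_word (by omega) s [] y ((M + 1, !s) :: v) hy
    have e' := hφ.cancel (i := M + 1) s y v (by omega)
    simp only [List.nil_append, List.cons_append] at e ⊢
    rw [e, e', hg.split (isWord_append.2 ⟨hy.mono (by omega), hv⟩)]
    exact .zero _
  · intro y c w hy hw
    have hy' : IsWord (M + 2) y := hy.mono (by omega)
    have hw' : IsWord (M + 2) w := hw.mono (by omega)
    have e1 := hφ.comm_word (by omega) s [] y ((M, c) :: (w ++ (M + 1, !s) :: v)) hy
    have e2 := hφ.comm_word (by omega) (!s) (y ++ [(M + 1, s), (M, c)]) w v hw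
    have e3 := hφ.conj (i := M) (by omega) s c y (w ++ v)
    have e4 := hg.destabilize (N := M + 1) c (u := y ++ [(M, !s)]) (v := (M, s) :: (w ++ v))
      (by simp [isWord_append, isWord_cons, isWord_nil, hy'])
      (by simp [isWord_append, isWord_cons, hw', hv])
    have e5 := hg.cancel (n := M + 2) (i := M) (!s) y (w ++ v) (by omega)
    simp only [List.append_assoc, List.cons_append, List.nil_append, Bool.not_not]
      at e1 e2 e3 e4 e5 ⊢
    rw [e1, ← e2, e3, e4, e5]
    have := hg.degLE (M + 1) (W := y ++ (w ++ v)) (by simp [isWord_append, *])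
    exact this.mono (by simp; omega)

/-- Flipping the second occurrence makes equal signs opposite, and the skein correction
destabilizes. So up to terms two degrees below the general bound, the value sees only whether the
signs agree and the trace of uv. -/
theorem degLE_two (hg : IsConwayTrace g) (N : ℕ) (s t : Bool) {u v : List Letter} (hu : IsWord (N + 1) u)
    (hv : IsWord (N + 1) v) :
    DegLE (g (N + 2) ((N, s) :: (u ++ (N, t) :: v)) -
      if s = t then signX s * g (N + 1) (u ++ v) else 0) (u.length + v.length - N - 1) := by
  by_cases hst : s = t
  · subst hst
    rw [if_pos rfl]
    have := (hg.functional (N + 2)).flip (i := N) s ((N, s) :: u) v (by omega)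
    have e := hg.destabilize s (u := []) (isWord_nil _) (isWord_append.2 ⟨hu, hv⟩)
    simp only [List.cons_append, List.nil_append] at this e
    rw [this, e, add_sub_cancel_right]
    exact hg.degLE_opposite N s hu hv
  · obtain rfl : t = !s := by cases t <;> cases s <;> simp_all
    rw [if_neg hst, sub_zero]
    exact hg.degLE_opposite N s hu hv

/-- To leading order, the last generator commutes with the others. -/
theorem degLE_commutator (hg : IsConwayTrace g) (N : ℕ) (s : Bool) (a : Letter) (ha : a.1 + 1 < N + 1)
    {u v : List Letter} (hu : IsWord (N + 2) u) (hv : IsWord (N + 2) v) :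
    DegLE (g (N + 2) (u ++ (N, s) :: a :: v) - g (N + 2) (u ++ a :: (N, s) :: v))
      (u.length + v.length - N) := by
  have hφ := hg.functional (N + 2)
  -- Rotation gathers the context into one word y, and a difference of functionals is again one, so
  -- y may be taken to contain the last generator at most once. The bound to prove is one below that
  -- of `degLE`.
  have key := DegLE.of_reduced N
    (φ := fun y => g (N + 2) ([(N, s), a] ++ (y ++ [])) - g (N + 2) ([a, (N, s)] ++ (y ++ [])))
    (C := -N) ((hφ.context _ _).sub (hφ.context _ _)) ?_ ?_ (v ++ u)
    (isWord_append.2 ⟨hv, hu⟩)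
  · rw [hg.rotate_append _ u, hg.rotate_append _ u]
    simp only [List.append_nil, List.cons_append, List.nil_append] at key ⊢
    exact key.mono (by simp; omega)
  · intro y hy
    have e1 := hg.destabilize s (u := []) (v := a :: y) (isWord_nil _) (isWord_cons.2 ⟨ha, hy⟩)
    have e2 := hg.destabilize s (u := [a]) (v := y) (isWord_cons.2 ⟨ha, isWord_nil _⟩) hy
    simp only [List.append_nil, List.cons_append, List.nil_append] at e1 e2 ⊢
    rw [e1, e2, sub_self]
    exact .zero _
  · intro y t w hy hw
    have e1 := hg.degLE_two N s t (u := a :: y) (v := w) (isWord_cons.2 ⟨ha, hy⟩) hw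
    have e2 := hg.degLE_two N s t (u := y) (v := w ++ [a]) hy
      (isWord_append.2 ⟨hw, isWord_cons.2 ⟨ha, isWord_nil _⟩⟩)
    have r1 := hg.rotate (N + 2) a ((N, s) :: (y ++ (N, t) :: w))
    have r2 := hg.rotate (N + 1) a (y ++ w)
    simp only [List.append_nil, List.cons_append, List.nil_append, List.append_assoc]
      at e1 e2 r1 r2 ⊢
    rw [r1]
    rw [← r2] at e2
    -- By rotation both values have the same main term, which cancels.
    have := e1.sub (e2.mono (show _ ≤ _ by simp; omega))
    rw [sub_sub_sub_cancel_right] at this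
    exact this.mono (by simp; omega)

/-- To leading order, the last generator commutes with words in the others. -/
theorem degLE_commutator_word (hg : IsConwayTrace g) (N : ℕ) (s : Bool) {u y v : List Letter} (hu : IsWord (N + 2) u)
    (hy : IsWord (N + 1) y) (hv : IsWord (N + 2) v) :
    DegLE (g (N + 2) (u ++ (N, s) :: (y ++ v)) - g (N + 2) (u ++ (y ++ (N, s) :: v)))
      (u.length + y.length + v.length - N - 1) := by
  induction y generalizing u with
  | nil => simpa using DegLE.zero _
  | cons a y ih =>
    obtain ⟨h1, h2⟩ := isWord_cons.1 hy
    have hy' : IsWord (N + 2) y := h2.mono (by omega)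
    have e1 := hg.degLE_commutator N s a h1 hu (v := y ++ v) (isWord_append.2 ⟨hy', hv⟩)
    have e2 := ih (u := u ++ [a])
      (isWord_append.2 ⟨hu, isWord_cons.2 ⟨by omega, isWord_nil _⟩⟩) h2
    simp only [List.cons_append, List.nil_append, List.append_assoc] at e1 e2 ⊢
    have := (e1.mono (show _ ≤ (u.length + (y.length + 1) + v.length - N - 1 : ℤ) by
      simp; omega)).add (e2.mono (by simp; omega))
    rw [sub_add_sub_cancel] at this
    exact this.mono (by simp)

end IsConwayTrace

/-! ## Homogeneous braid words -/

def signOf (s : Bool) : ℤ := if s then 1 else -1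

theorem signOf_mul_self (s : Bool) : signOf s * signOf s = 1 := by cases s <;> rfl

theorem signOf_ne_zero (s : Bool) : signOf s ≠ 0 := by cases s <;> simp [signOf]

theorem coeff_signX_mul (s : Bool) (P : ℤ[X]) (d : ℕ) :
    (signX s * P).coeff (d + 1) = signOf s * P.coeff d := by
  cases s <;> simp [signX, signOf, coeff_X_mul]

/-- Outer induction on strands, inner on length. Each deletion of a repeated last letter contributes
its sign; the final destabilization contributes none, matching α(N) from the generators times α(N)
from the letter. -/
theorem IsConwayTrace.coeff_homogeneous {g : ℕ → List Letter → ℤ[X]} (hg : IsConwayTrace g)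
    (α : ℕ → Bool) (N : ℕ) {W : List Letter} (hW : IsWord (N + 1) W)
    (hα : ∀ a ∈ W, a.2 = α a.1) (hmem : ∀ i < N, (i, α i) ∈ W) :
    ∃ d, W.length = N + d ∧ (g (N + 1) W).coeff d =
      (∏ i ∈ Finset.range N, signOf (α i)) * (W.map fun a => signOf a.2).prod := by
  induction N generalizing W with
  | zero =>
    obtain rfl := isWord_one hW
    exact ⟨0, rfl, by simp [hg.one]⟩
  | succ N ihN =>
    induction hk : W.length using Nat.strong_induction_on generalizing W with
    | _ k ih =>
    have hW0 : ¬ IsWord (N + 1) W := fun h => by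
      have := h _ (hmem N (by omega))
      simp at this
    obtain ⟨u, s, v, rfl, hu, hv⟩ := exists_eq_append_of_not_isWord hW hW0
    obtain rfl : s = α N := hα (N, s) (by simp)
    by_cases hv0 : IsWord (N + 1) v
    · obtain ⟨d, hd, hc⟩ := ihN (W := u ++ v) (isWord_append.2 ⟨hu, hv0⟩)
        (fun a ha => hα a (by simp at ha ⊢; tauto))
        (fun i hi => by
          have := hmem i (by omega)
          have hne : i ≠ N := by omega
          simpa [hne] using this)
      refine ⟨d, by simp at hd hk ⊢; omega, ?_⟩
      rw [hg.destabilize _ hu hv0, hc, Finset.prod_range_succ]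
      simp only [List.map_append, List.prod_append, List.map_cons, List.prod_cons]
      linear_combination (-(∏ i ∈ Finset.range N, signOf (α i)) *
        (u.map fun a => signOf a.2).prod * (v.map fun a => signOf a.2).prod) *
        signOf_mul_self (α N)
    · obtain ⟨y, t, v', rfl, hy, hv'⟩ := exists_eq_append_of_not_isWord hv hv0
      obtain rfl : t = α N := hα (N, t) (by simp)
      have hu' : IsWord (N + 2) u := hu.mono (by omega)
      have hy' : IsWord (N + 2) y := hy.mono (by omega)
      have hlt : (u ++ (y ++ (N, α N) :: v')).length < k := by
        rw [← hk]; simp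
      obtain ⟨d, hd, hc⟩ := ih _ hlt (W := u ++ (y ++ (N, α N) :: v'))
        (by simp [isWord_append, *])
        (fun a ha => hα a (by simp at ha ⊢; tauto))
        (fun i hi => by
          have := hmem i hi
          simp at this ⊢
          tauto) rfl
      have e1 := hg.degLE_commutator_word N (α N) hu' hy (v := (N, α N) :: v')
        (isWord_cons.2 ⟨by simp, hv'⟩)
      have e2 := (hg.functional (N + 2)).square (i := N) (α N) (u ++ y) v' (by omega)
      have e3 := hg.degLE (N + 1) (W := u ++ (y ++ v')) (by simp [isWord_append, *])
      simp only [List.append_assoc] at e2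
      have hd' : u.length + (y.length + (v'.length + 1)) = N + 1 + d := by simpa using hd
      refine ⟨d + 1, by rw [← hk]; simp; omega, ?_⟩
      -- In degree d + 1 both the commutator error and the term 1 of σ² = 1 ± zσ vanish; only ±z
      -- times the shorter word survives.
      have c1 := e1 (d + 1) (by simp; omega)
      have c3 := e3 (d + 1) (by simp; omega)
      rw [coeff_sub, e2, coeff_add, c3, zero_add, coeff_signX_mul, hc, sub_eq_zero] at c1
      rw [c1]
      simp only [List.map_append, List.prod_append, List.map_cons, List.prod_cons]
      ring

theorem signOf_prod_ne_zero (W : List Letter) : (W.map fun a => signOf a.2).prod ≠ 0 :=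
  List.prod_ne_zero fun h => by
    obtain ⟨a, -, ha⟩ := List.mem_map.1 h
    exact signOf_ne_zero _ ha

theorem conway_closure_eq {n : ℕ} (hn : 1 ≤ n) (w : BraidWord n)
    (hW : IsWord n (w.map fun a => ((a.1 : ℕ), a.2))) :
    conway (w.closure hn).link = closureValue conway n (w.map fun a => ((a.1 : ℕ), a.2)) := by
  rw [closureValue, dif_pos ⟨hn, hW⟩]
  refine congrArg (fun D => conway (Diagram.link D)) (Diagram.ext ?_)
  simp [BraidWord.closure, BraidWord.closureEvents, closedBraid, maxima, minima, crossings,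
    Function.comp_def]

theorem conway_closure_of_homogeneous (n : ℕ) (hn : 1 ≤ n) (w : BraidWord n)
    (hw : w.Homogeneous) :
    ((conway (w.closure hn).link).natDegree : ℤ) = (w.length : ℤ) - (n : ℤ) + 1 ∧
    (conway (w.closure hn).link).leadingCoeff =
      (∏ i : Fin (n - 1), w.exponentSign i) *
        ∏ j : Fin w.length, w.exponentSign (w.get j).1 := by
  obtain ⟨N, rfl⟩ := Nat.exists_eq_add_of_le' hn
  have hg := isConwayTrace_closureValue isConwayPolynomial_conway
  have hW : IsWord (N + 1) (w.map fun a => ((a.1 : ℕ), a.2)) := by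
    intro a ha
    obtain ⟨b, -, rfl⟩ := List.mem_map.1 ha
    simp
  -- The value `true` beyond the last generator is a mere default.
  let α : ℕ → Bool := fun i => if h : i < N then decide ((⟨i, h⟩, true) ∈ w) else true
  have hα : ∀ i : Fin N, w.exponentSign i = signOf (α i) := by
    intro i
    simp [BraidWord.exponentSign, signOf, α]
  have hα' : ∀ a ∈ w, a.2 = α a.1 := by
    rintro ⟨i, s⟩ ha
    have hi : (i : ℕ) < N := i.2
    have := hw i
    cases s
    · simp only [α, dif_pos hi]
      simp only [ha, not_true_eq_false, iff_false] at this
      exact (decide_eq_false this).symm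
    · simp only [α, dif_pos hi]
      exact (decide_eq_true ha).symm
  obtain ⟨d, hd, hc⟩ := hg.coeff_homogeneous α N hW
    (fun a ha => by
      obtain ⟨b, hb, rfl⟩ := List.mem_map.1 ha
      exact hα' b hb)
    (fun i hi => by
      refine List.mem_map.2 ⟨(⟨i, hi⟩, α i), ?_, rfl⟩
      by_cases h : ((⟨i, hi⟩, true) : Fin N × Bool) ∈ w
      · simp [α, hi, h]
      · have h' := not_not.1 (mt (hw ⟨i, hi⟩).2 h)
        simpa [α, hi, h] using h')
  have hdeg := hg.degLE N hW
  rw [← conway_closure_eq hn w hW] at hc hdeg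
  have hd' : w.length = N + d := by simpa using hd
  have hne : (conway (w.closure hn).link).coeff d ≠ 0 := by
    rw [hc]
    exact mul_ne_zero (Finset.prod_ne_zero_iff.2 fun i _ => signOf_ne_zero _)
      (signOf_prod_ne_zero _)
  have hnat : (conway (w.closure hn).link).natDegree = d := by
    refine natDegree_eq_of_le_of_coeff_ne_zero (natDegree_le_iff_coeff_eq_zero.2 fun k hk => ?_) hne
    exact hdeg k (by simp; omega)
  refine ⟨by rw [hnat]; push_cast; omega, ?_⟩
  rw [leadingCoeff, hnat, hc]
  congr 1
  · rw [Finset.prod_range]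
    exact Finset.prod_congr rfl fun i _ => (hα i).symm
  · have : ∀ a ∈ w, signOf a.2 = w.exponentSign a.1 := fun a ha => by rw [hα, ← hα' a ha]
    rw [List.map_map]
    exact (congrArg List.prod (List.map_congr_left this)).trans
      (Fin.prod_univ_fun_getElem w fun a => w.exponentSign a.1).symm

end Knot

theorem mainTheorem2 (n : ℕ) (hn : 1 ≤ n) (w : Knot.BraidWord n) (hw : w.Homogeneous) :
    ((Knot.conway (w.closure hn).link).natDegree : ℤ) = (w.length : ℤ) - (n : ℤ) + 1 ∧
    (Knot.conway (w.closure hn).link).leadingCoeff =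
      (∏ i : Fin (n - 1), w.exponentSign i) *
        ∏ j : Fin w.length, w.exponentSign (w.get j).1 :=
  Knot.conway_closure_of_homogeneous n hn w hw
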